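/- Theorem 1.5. Let $Q=[0,1]^\omega$ be the Hilbert cube. A Cantor set in a topological space is a subset homeomorphic to $\{0,1\}^\omega$; a Cantor set $A\subseteq Q$ is minimal if for every Cantor set $B\subseteq Q$ there is a homeomorphism $h:Q\to Q$ with $h(A)\subseteq B$ (equivalently, $A$ is a Cantor set that is a $Z$-set in $Q$). Let $\sigma\mathcal C_0$ be the $\sigma$-ideal of all subsets of countable unions of minimal Cantor sets in $Q$, and let $\mathcal M$ be the $\sigma$-ideal of meager subsets of $Q$. For a family $\mathcal I$ of subsets of a set $X$ put $$\mathrm{add}(\mathcal I)=\min\{|\mathcal A|:\mathcal A\subseteq\mathcal I,\ \textstyle\bigcup\mathcal A\notin\mathcal I\},\qquad \mathrm{non}(\mathcal I)=\min\{|A|:A\subseteq X,\ A\notin\mathcal I\},$$ $$\mathrm{cov}(\mathcal I)=\min\{|\mathcal A|:\mathcal A\subseteq\mathcal I,\ \textstyle\bigcup\mathcal A=X\},\qquad \mathrm{cof}(\mathcal I)=\min\{|\mathcal A|:\mathcal A\subseteq\mathcal I,\ \forall B\in\mathcal I\ \exists A\in\mathcal A\ (B\subseteq A)\},$$ and for families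 $\mathcal I\subseteq\mathcal J$ put $$\mathrm{add}(\mathcal I,\mathcal J)=\min\{|\mathcal A|:\mathcal A\subseteq\mathcal I,\ \textstyle\bigcup\mathcal A\notin\mathcal J\},\qquad \mathrm{cof}(\mathcal I,\mathcal J)=\min\{|\mathcal A|:\mathcal A\subseteq\mathcal J,\ \forall B\in\mathcal I\ \exists A\in\mathcal A\ (B\subseteq A)\}.$$ Then 1. $\mathrm{cov}(\sigma\mathcal C_0)=\mathrm{cov}(\mathcal M)$; 2. $\mathrm{non}(\sigma\mathcal C_0)=\mathrm{non}(\mathcal M)$; 3. $\mathrm{add}(\sigma\mathcal C_0,\mathcal M)=\mathrm{add}(\mathcal M)$; 4. $\mathrm{cof}(\sigma\mathcal C_0,\mathcal M)=\mathrm{cof}(\mathcal M)$. Moreover, the least cardinality of a family of Cantor sets covering the unit interval $[0,1]$ equals the least cardinality of a family of Cantor sets covering the Hilbert cube. -/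

import Mathlib

noncomputable section

open Set

/-- The Hilbert cube `[0,1]^ω` with the product topology. -/
abbrev HilbertCube : Type := ℕ → unitInterval

/-- A Cantor set in a space `X` is a subset homeomorphic to the Cantor cube `{0,1}^ω`. -/
def IsCantorSet {X : Type*} [TopologicalSpace X] (C : Set X) : Prop :=
  Nonempty (C ≃ₜ (ℕ → Bool))

/-- A Cantor set `A` in `X` is minimal if every Cantor set `B` in `X` contains the image of `A`
under some homeomorphism of the whole space `X`. -/
def IsMinimalCantorSet {X : Type*} [TopologicalSpace X] (A : Set X) : Prop :=
  IsCantorSet A ∧ ∀ B : Set X, IsCantorSet B → ∃ h : X ≃ₜ X, h '' A ⊆ B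

/-- The σ-ideal generated by a family `F` of subsets of `X`: all subsets of countable unions of
members of `F`. -/
def sigmaIdeal {X : Type*} (F : Set (Set X)) : Set (Set X) :=
  {A | ∃ 𝒜 : Set (Set X), 𝒜 ⊆ F ∧ 𝒜.Countable ∧ A ⊆ ⋃₀ 𝒜}

/-- The σ-ideal `σC₀` generated by the minimal Cantor sets in the Hilbert cube. -/
def sigmaC₀ : Set (Set HilbertCube) :=
  sigmaIdeal {A | IsMinimalCantorSet A}

/-- The ideal of meager subsets of `X`. -/
def meagerIdeal (X : Type*) [TopologicalSpace X] : Set (Set X) :=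
  {A | IsMeagre A}

universe u

/-- `add(I, J)`: the least size of a subfamily of `I` whose union is not in `J`. -/
def addPair {X : Type u} (I J : Set (Set X)) : Cardinal.{u} :=
  sInf {κ | ∃ 𝒜 : Set (Set X), 𝒜 ⊆ I ∧ ⋃₀ 𝒜 ∉ J ∧ Cardinal.mk 𝒜 = κ}

/-- `cof(I, J)`: the least size of a subfamily of `J` such that every member of `I` is contained
in some member of the subfamily. -/
def cofPair {X : Type u} (I J : Set (Set X)) : Cardinal.{u} :=
  sInf {κ | ∃ 𝒜 : Set (Set X), 𝒜 ⊆ J ∧ (∀ B ∈ I, ∃ A ∈ 𝒜, B ⊆ A) ∧ Cardinal.mk 𝒜 = κ}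

/-- `add(I)`: the least size of a subfamily of `I` whose union is not in `I`. -/
def addIdeal {X : Type u} (I : Set (Set X)) : Cardinal.{u} :=
  sInf {κ | ∃ 𝒜 : Set (Set X), 𝒜 ⊆ I ∧ ⋃₀ 𝒜 ∉ I ∧ Cardinal.mk 𝒜 = κ}

/-- `non(I)`: the least size of a subset of `X` that is not in `I`. -/
def nonIdeal {X : Type u} (I : Set (Set X)) : Cardinal.{u} :=
  sInf {κ | ∃ A : Set X, A ∉ I ∧ Cardinal.mk A = κ}

/-- `cov(I)`: the least size of a subfamily of `I` that covers `X`. The definition makes sense for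
an arbitrary family `I` of subsets, for instance for the family of all Cantor sets in `X`. -/
def covIdeal {X : Type u} (I : Set (Set X)) : Cardinal.{u} :=
  sInf {κ | ∃ 𝒜 : Set (Set X), 𝒜 ⊆ I ∧ ⋃₀ 𝒜 = univ ∧ Cardinal.mk 𝒜 = κ}

/-- `cof(I)`: the least size of a base of `I`. -/
def cofIdeal {X : Type u} (I : Set (Set X)) : Cardinal.{u} :=
  sInf {κ | ∃ 𝒜 : Set (Set X), 𝒜 ⊆ I ∧ (∀ B ∈ I, ∃ A ∈ 𝒜, B ⊆ A) ∧ Cardinal.mk 𝒜 = κ}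

end

open Set Filter Topology

/-! ### Digit expansions -/

/-! Cantor sets in the cube are closed and nowhere dense, so the ideal of the minimal ones lies in
the meagre ideal; this gives one inequality in each of the four equalities. The others rest on a
topological fact and on Bartoszyński-style combinatorics of category.

The topological fact is `pi_mem_sigmaC₀`: countably many minimal Cantor sets cover any product of
closed nowhere dense subsets of the interval. A coordinatewise homeomorphism carries the product
into a power of one Cantor set, given by base-8 digits 0 and 7. This power splits into the corner
set and countably many pieces in which some coordinate has a prescribed digit 0 and a prescribed
digit 7, hence stays uniformly away from the end-points. That leaves room to shear this coordinate
by a small code of half of the coordinates; the projection to the other half becomes injective, and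
Klee's graph trick (`exists_homeomorph_graph`) straightens the embedding. Thus all Cantor embeddings
into a piece are ambiently equivalent to one fixed embedding (`IsStandard`). Every Cantor set
contains a standard one, by a measure argument (`exists_pi_inter_not_countable`) and the perfect set
theorem, so the pieces are minimal.

For the combinatorics, the ideal contains `avoidSet f`, outside which every point codes a function
infinitely often equal to `f`, and `hitSet f`, for which any meagre superset determines an eventual
bound of `f`. Conversely, two infinitely-often-equal guesses produce a point outside a meagre set
(`IsMeagre.exists_guess`), and a bound, a guess and a second bound produce a meagre superset of it
(`IsMeagre.exists_cover`). The former settles cov and non, the latter add and cof.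

Both Cantor covering numbers equal cov of the meagre ideal: an eventually different family yields
Cantor covers of the cube and of the interval, and a Cantor cover of the interval pulls back to a
meagre cover of the cube. -/

theorem ofDigits_eight_injective {a b : ℕ → Fin 8} (ha : ∀ n, (a n : ℕ) ≤ 3)
    (hb : ∀ n, (b n : ℕ) ≤ 3) (h : Real.ofDigits a = Real.ofDigits b) : a = b := by
  by_contra hne
  have hex : ∃ n, a n ≠ b n := Function.ne_iff.mp hne
  classical
  obtain ⟨n, hn, hmin⟩ : ∃ n, a n ≠ b n ∧ ∀ m < n, a m = b m :=
    ⟨Nat.find hex, Nat.find_spec hex, fun m hm => by simpa using Nat.find_min hex hm⟩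
  clear hex hne
  wlog hlt : a n < b n generalizing a b
  · exact this hb ha h.symm hn.symm (fun m hm => (hmin m hm).symm)
      (lt_of_le_of_ne (not_lt.mp hlt) hn.symm)
  have hsum : ∑ i ∈ Finset.range n, Real.ofDigitsTerm a i =
      ∑ i ∈ Finset.range n, Real.ofDigitsTerm b i :=
    Finset.sum_congr rfl fun i hi => by
      simp [Real.ofDigitsTerm, hmin i (Finset.mem_range.mp hi)]
  -- A tail with digits at most 3 is worth at most half a unit of the preceding place, so it cannot
  -- make up for a difference of digits.
  have h1 : ∀ c : ℕ → Fin 8, (∀ n, (c n : ℕ) ≤ 3) → Real.ofDigits c ≤ 1 / 2 := by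
    intro c hc
    have := Real.ofDigits_eq_sum_add_ofDigits c 1
    have h2 := Real.ofDigits_le_one (fun i => c (i + 1))
    have h3 : ((c 0 : ℕ) : ℝ) ≤ 3 := by exact_mod_cast hc 0
    simp [Real.ofDigitsTerm] at this
    rw [this]
    linarith
  rw [Real.ofDigits_eq_sum_add_ofDigits a (n + 1), Real.ofDigits_eq_sum_add_ofDigits b (n + 1),
    Finset.sum_range_succ, Finset.sum_range_succ, hsum] at h
  have hA := h1 (fun i => a (i + (n + 1))) (fun _ => ha _)
  have hB := Real.ofDigits_nonneg (fun i => b (i + (n + 1)))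
  have hd : ((a n : ℕ) : ℝ) + 1 ≤ ((b n : ℕ) : ℝ) := by exact_mod_cast hlt
  have hp : (0 : ℝ) < ((8 : ℝ) ^ (n + 1))⁻¹ := by positivity
  simp only [Real.ofDigitsTerm, Nat.cast_ofNat] at h
  nlinarith

/-- The point of the unit interval whose base-8 digits are `7` where `e` is true and `0`
elsewhere. -/
noncomputable def sparsePoint (e : ℕ → Bool) : unitInterval :=
  ⟨Real.ofDigits (fun n => if e n then (7 : Fin 8) else 0),
    Real.ofDigits_nonneg _, Real.ofDigits_le_one _⟩

/-- The point of the unit interval with the binary expansion `w`. -/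
noncomputable def binaryPoint (w : ℕ → Bool) : unitInterval :=
  ⟨Real.ofDigits (fun n => if w n then (1 : Fin 2) else 0),
    Real.ofDigits_nonneg _, Real.ofDigits_le_one _⟩

theorem continuous_ofDigits_comp {b : ℕ} (x y : Fin b) :
    Continuous fun e : ℕ → Bool => Real.ofDigits (fun n => if e n then x else y) := by
  refine Real.continuous_ofDigits.comp (continuous_pi fun n => ?_)
  exact (continuous_of_discreteTopology (f := fun c : Bool => if c then x else y)).comp
    (continuous_apply n)

theorem continuous_sparsePoint : Continuous sparsePoint :=
  Continuous.subtype_mk (continuous_ofDigits_comp _ _) _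

theorem continuous_binaryPoint : Continuous binaryPoint :=
  Continuous.subtype_mk (continuous_ofDigits_comp _ _) _

theorem sparsePoint_eq_tsum (e : ℕ → Bool) :
    (sparsePoint e : ℝ) = ∑' n, (if e n then (7 : ℝ) else 0) * ((8 : ℝ) ^ (n + 1))⁻¹ := by
  simp only [sparsePoint, Real.ofDigits, Real.ofDigitsTerm]
  refine tsum_congr fun n => ?_
  cases e n <;> simp

theorem summable_sparse (e : ℕ → Bool) :
    Summable fun n => (if e n then (7 : ℝ) else 0) * ((8 : ℝ) ^ (n + 1))⁻¹ := by
  refine (Real.summable_ofDigitsTerm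
    (digits := fun n => if e n then (7 : Fin 8) else 0)).congr fun n => ?_
  simp only [Real.ofDigitsTerm]
  cases e n <;> simp

/-- Place by place, `7e + 7s/2 = (7/2)(2e + s)`, and `2e + s` is a digit at most 3. Both bit
sequences can therefore be read off the sum. -/
theorem sparsePoint_add_half (e s : ℕ → Bool) :
    (sparsePoint e : ℝ) + sparsePoint s / 2 = 7 / 2 * Real.ofDigits (fun n =>
      if e n then (if s n then (3 : Fin 8) else 2) else (if s n then 1 else 0)) := by
  rw [sparsePoint_eq_tsum, sparsePoint_eq_tsum, ← tsum_div_const,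
    ← (summable_sparse e).tsum_add ((summable_sparse s).div_const 2), Real.ofDigits,
    ← tsum_mul_left]
  refine tsum_congr fun n => ?_
  simp only [Real.ofDigitsTerm]
  cases e n <;> cases s n <;> simp <;> ring

theorem sparsePoint_add_half_injective {e s e' s' : ℕ → Bool}
    (h : (sparsePoint e : ℝ) + sparsePoint s / 2 = sparsePoint e' + sparsePoint s' / 2) :
    e = e' ∧ s = s' := by
  rw [sparsePoint_add_half, sparsePoint_add_half] at h
  have h' := ofDigits_eight_injective
    (fun n => by cases e n <;> cases s n <;> simp)
    (fun n => by cases e' n <;> cases s' n <;> simp) (mul_left_cancel₀ (by norm_num) h)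
  constructor <;> funext n <;> have hn := congrFun h' n <;> revert hn <;>
    cases e n <;> cases s n <;> cases e' n <;> cases s' n <;> simp [Fin.ext_iff]

theorem sparsePoint_injective : Function.Injective sparsePoint := fun e e' h =>
  (sparsePoint_add_half_injective (s := fun _ => false) (s' := fun _ => false)
    (by rw [h])).1

theorem sparsePoint_le_of_false {e : ℕ → Bool} {N : ℕ} (h : ∀ n < N, e n = false) :
    (sparsePoint e : ℝ) ≤ ((8 : ℝ) ^ N)⁻¹ := by
  have h0 : Real.ofDigits (fun _ : ℕ => (0 : Fin 8)) = 0 := by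
    simp [Real.ofDigits, Real.ofDigitsTerm]
  have := Real.abs_ofDigits_sub_ofDigits_le (x := fun n => if e n then (7 : Fin 8) else 0)
    (y := fun _ => 0) (n := N) (fun i hi => by simp [h i hi])
  rw [h0, sub_zero] at this
  exact (le_abs_self _).trans this

theorem sparsePoint_not (e : ℕ → Bool) :
    (sparsePoint (fun n => !e n) : ℝ) = 1 - sparsePoint e := by
  have h1 : Real.ofDigits (fun _ : ℕ => (7 : Fin 8)) = 1 := by
    have := Real.ofDigits_const_last_eq_one 7
    exact this
  rw [eq_sub_iff_add_eq, sparsePoint_eq_tsum, sparsePoint_eq_tsum,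
    ← (summable_sparse _).tsum_add (summable_sparse e), ← h1, Real.ofDigits]
  refine tsum_congr fun n => ?_
  simp only [Real.ofDigitsTerm]
  cases e n <;> simp

theorem le_sparsePoint_of_true {e : ℕ → Bool} {k : ℕ} (h : e k = true) :
    ((8 : ℝ) ^ (k + 1))⁻¹ ≤ sparsePoint e := by
  rw [sparsePoint_eq_tsum]
  refine le_trans ?_ ((summable_sparse e).le_tsum k fun n _ => by positivity)
  have hp : (0 : ℝ) < ((8 : ℝ) ^ (k + 1))⁻¹ := by positivity
  simp only [h, if_true]
  linarith

theorem sparsePoint_le_of_eq_false {e : ℕ → Bool} {k : ℕ} (h : e k = false) :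
    (sparsePoint e : ℝ) ≤ 1 - ((8 : ℝ) ^ (k + 1))⁻¹ := by
  have := le_sparsePoint_of_true (e := fun n => !e n) (k := k) (by simp [h])
  rw [sparsePoint_not] at this
  linarith

theorem sparsePoint_gap (e : ℕ → Bool) :
    (sparsePoint e : ℝ) ≤ 1 / 8 ∨ 7 / 8 ≤ (sparsePoint e : ℝ) := by
  cases h : e 0
  · left
    have := sparsePoint_le_of_false (e := e) (N := 1) (fun n hn => by
      obtain rfl : n = 0 := by omega
      exact h)
    norm_num at this ⊢
    exact this
  · right
    have := sparsePoint_le_of_false (e := fun n => !e n) (N := 1) (fun n hn => by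
      obtain rfl : n = 0 := by omega
      simp [h])
    rw [sparsePoint_not] at this
    norm_num at this ⊢
    linarith

theorem sparsePoint_const_false : sparsePoint (fun _ => false) = 0 := by
  apply Subtype.ext
  simp [sparsePoint_eq_tsum]

theorem sparsePoint_const_true : sparsePoint (fun _ => true) = 1 := by
  apply Subtype.ext
  have := sparsePoint_not (fun _ => false)
  simpa [sparsePoint_const_false] using this

theorem binaryPoint_surjective : Function.Surjective binaryPoint := by
  intro x
  obtain ⟨d, -, hd⟩ := Real.ofDigits_SurjOn (b := 2) (by norm_num) x.2
  refine ⟨fun n => decide (d n = 1), Subtype.ext ?_⟩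
  rw [← hd]
  change Real.ofDigits _ = _
  congr 1
  funext n
  have : ∀ t : Fin 2, (if decide (t = 1) = true then (1 : Fin 2) else 0) = t := by decide
  exact this (d n)

theorem ofDigits_two_eq_one {d : ℕ → Fin 2} (h : Real.ofDigits d = 1) (n : ℕ) : d n = 1 := by
  by_contra hn
  have h0 : d n = 0 := by
    have : ∀ t : Fin 2, t ≠ 1 → t = 0 := by decide
    exact this _ hn
  have hone := Real.ofDigits_const_last_eq_one 1
  have hlt : Real.ofDigits d < Real.ofDigits (fun _ => Fin.last 1) := by
    refine Summable.tsum_lt_tsum (i := n) (fun k => ?_) ?_ Real.summable_ofDigitsTerm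
      Real.summable_ofDigitsTerm
    · simp only [Real.ofDigitsTerm]
      gcongr
      exact Fin.le_last _
    · simp [Real.ofDigitsTerm, h0]
  rw [hone, h] at hlt
  exact lt_irrefl _ hlt

theorem ofDigits_two_eq_zero {d : ℕ → Fin 2} (h : Real.ofDigits d = 0) (n : ℕ) : d n = 0 := by
  have := (hasSum_zero_iff_of_nonneg (fun _ => Real.ofDigitsTerm_nonneg)).mp
    (show HasSum (Real.ofDigitsTerm d) 0 from
      h ▸ show HasSum _ (Real.ofDigits d) from Real.summable_ofDigitsTerm.hasSum)
  have hn := congrFun this n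
  simp only [Real.ofDigitsTerm, Pi.zero_apply, mul_eq_zero, inv_eq_zero] at hn
  rcases hn with hn | hn
  · exact Fin.ext (Nat.cast_eq_zero.mp hn)
  · exact absurd hn (by positivity)

/-- The binary sequences that are not eventually constant. -/
def nondyadic : Set (ℕ → Bool) :=
  {w | ∀ n, (∃ k ≥ n, w k = true) ∧ ∃ k ≥ n, w k = false}

/-- Two expansions of one number continue with constant tails after their first difference. -/
theorem eq_of_binaryPoint_eq {w v : ℕ → Bool} (hw : w ∈ nondyadic)
    (h : binaryPoint v = binaryPoint w) : v = w := by
  by_contra hne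
  have hex : ∃ n, v n ≠ w n := Function.ne_iff.mp hne
  classical
  obtain ⟨n, hn, hmin⟩ : ∃ n, v n ≠ w n ∧ ∀ m < n, v m = w m :=
    ⟨Nat.find hex, Nat.find_spec hex, fun m hm => by simpa using Nat.find_min hex hm⟩
  have h' : Real.ofDigits (fun n => if v n then (1 : Fin 2) else 0) =
      Real.ofDigits (fun n => if w n then (1 : Fin 2) else 0) := congrArg Subtype.val h
  have hsum : ∑ i ∈ Finset.range n,
        Real.ofDigitsTerm (fun n => if v n then (1 : Fin 2) else 0) i =
      ∑ i ∈ Finset.range n, Real.ofDigitsTerm (fun n => if w n then (1 : Fin 2) else 0) i :=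
    Finset.sum_congr rfl fun i hi => by
      simp [Real.ofDigitsTerm, hmin i (Finset.mem_range.mp hi)]
  rw [Real.ofDigits_eq_sum_add_ofDigits _ (n + 1), Real.ofDigits_eq_sum_add_ofDigits
    (fun n => if w n then (1 : Fin 2) else 0) (n + 1),
    Finset.sum_range_succ, Finset.sum_range_succ, hsum] at h'
  simp only [Real.ofDigitsTerm, Nat.cast_ofNat] at h'
  have hp : (0 : ℝ) < ((2 : ℝ) ^ (n + 1))⁻¹ := by positivity
  set A := Real.ofDigits (fun i => if v (i + (n + 1)) then (1 : Fin 2) else 0) with hA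
  set B := Real.ofDigits (fun i => if w (i + (n + 1)) then (1 : Fin 2) else 0) with hB
  have hA0 : 0 ≤ A := Real.ofDigits_nonneg _
  have hB0 : 0 ≤ B := Real.ofDigits_nonneg _
  have hA1 : A ≤ 1 := Real.ofDigits_le_one _
  have hB1 : B ≤ 1 := Real.ofDigits_le_one _
  cases hv : v n <;> cases hw' : w n
  · exact hn (hv.trans hw'.symm)
  · simp [hv, hw'] at h'
    have hB' : B = 0 := by nlinarith
    obtain ⟨k, hk, hkt⟩ := (hw (n + 1)).1
    have := ofDigits_two_eq_zero hB' (k - (n + 1))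
    rw [Nat.sub_add_cancel hk, hkt] at this
    simp at this
  · simp [hv, hw'] at h'
    have hB' : B = 1 := by nlinarith
    obtain ⟨k, hk, hkt⟩ := (hw (n + 1)).2
    have := ofDigits_two_eq_one hB' (k - (n + 1))
    rw [Nat.sub_add_cancel hk, hkt] at this
    simp at this
  · exact hn (hv.trans hw'.symm)

theorem dense_nondyadic : Dense nondyadic := by
  rw [dense_iff_closure_eq, eq_univ_iff_forall]
  intro w
  refine mem_closure_of_tendsto (b := Filter.atTop)
    (f := fun N : ℕ => fun k => if k < N then w k else decide (Even k)) ?_ ?_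
  · rw [tendsto_pi_nhds]
    intro k
    refine tendsto_const_nhds.congr' ?_
    filter_upwards [Filter.eventually_gt_atTop k] with N hN
    simp [hN]
  · refine Filter.Eventually.of_forall fun N n => ⟨⟨2 * (n + N), by omega, ?_⟩,
      ⟨2 * (n + N) + 1, by omega, ?_⟩⟩
    · simp only [show ¬ 2 * (n + N) < N by omega, if_false]
      simp
    · simp only [show ¬ 2 * (n + N) + 1 < N by omega, if_false]
      simp

/-! ### Homeomorphisms of the interval and of the Hilbert cube -/

theorem exists_homeomorph_of_bijective {X : Type*} [TopologicalSpace X] [CompactSpace X]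
    [T2Space X] {F : X → X} (hc : Continuous F) (hb : Function.Bijective F) :
    ∃ h : X ≃ₜ X, ∀ x, h x = F x :=
  ⟨Continuous.homeoOfEquivCompactToT2 (f := Equiv.ofBijective F hb) hc, fun _ => rfl⟩

theorem exists_homeomorph_unitInterval {g : ℝ → ℝ} (hc : Continuous g)
    (hm : StrictMonoOn g (Icc 0 1)) (h0 : g 0 = 0) (h1 : g 1 = 1) :
    ∃ h : unitInterval ≃ₜ unitInterval, ∀ x, (h x : ℝ) = g x := by
  have hmem : ∀ x : unitInterval, g x ∈ Icc (0 : ℝ) 1 := fun x =>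
    ⟨h0 ▸ hm.monotoneOn (by simp) x.2 x.2.1, h1 ▸ hm.monotoneOn x.2 (by simp) x.2.2⟩
  have hbij : Function.Bijective fun x : unitInterval => (⟨g x, hmem x⟩ : unitInterval) := by
    refine ⟨fun x y hxy => Subtype.ext (hm.injOn x.2 y.2 (congrArg Subtype.val hxy)), fun y => ?_⟩
    obtain ⟨x, hx, hxy⟩ := intermediate_value_Icc (zero_le_one (α := ℝ)) hc.continuousOn
      (show (y : ℝ) ∈ Icc (g 0) (g 1) by rw [h0, h1]; exact y.2)
    exact ⟨⟨x, hx⟩, Subtype.ext hxy⟩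
  obtain ⟨h, hh⟩ := exists_homeomorph_of_bijective (by fun_prop) hbij
  exact ⟨h, fun x => by rw [hh]⟩

/-- The piecewise linear function that increases from `0` to `1` on the interval `[a, b]`. -/
noncomputable def ramp (a b x : ℝ) : ℝ := max 0 (min 1 ((x - a) / (b - a)))

theorem continuous_ramp (a b : ℝ) : Continuous (ramp a b) := by
  unfold ramp
  fun_prop

theorem ramp_mono {a b : ℝ} (h : a < b) : Monotone (ramp a b) := fun x y hxy => by
  have : 0 < b - a := sub_pos.mpr h
  unfold ramp
  gcongr

theorem ramp_eq_zero {a b x : ℝ} (h : a < b) (hx : x ≤ a) : ramp a b x = 0 := by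
  have : (x - a) / (b - a) ≤ 0 := div_nonpos_of_nonpos_of_nonneg (by linarith) (by linarith)
  exact max_eq_left ((min_le_right _ _).trans this)

theorem ramp_eq_one {a b x : ℝ} (h : a < b) (hx : b ≤ x) : ramp a b x = 1 := by
  have : 1 ≤ (x - a) / (b - a) := by rw [one_le_div (by linarith)]; linarith
  rw [ramp, min_eq_left this]
  norm_num

theorem ramp_mem (a b x : ℝ) : ramp a b x ∈ Icc (0 : ℝ) 1 :=
  ⟨le_max_left _ _, max_le zero_le_one (min_le_left _ _)⟩

/-- A closed nowhere dense subset of the interval can be moved by a homeomorphism into the Cantor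
set of sparse points. -/
theorem exists_homeomorph_into_range_sparsePoint {A : Set unitInterval} (hA : IsClosed A)
    (hn : IsNowhereDense A) :
    ∃ g : unitInterval ≃ₜ unitInterval, ∀ a ∈ A, g a ∈ range sparsePoint := by
  -- Rational intervals missing `A`. The homeomorphism is a sum of ramps, the `n`-th rising by
  -- `7/8^(n+1)` across the `n`-th interval. On `A` every ramp is at its bottom or top, so the
  -- digits are 0 and 7; strict monotonicity holds because such intervals occur everywhere (`key`).
  let Γ := {p : ℚ × ℚ // 0 ≤ p.1 ∧ p.1 < p.2 ∧ p.2 ≤ 1 ∧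
    ∀ x ∈ A, ¬ ((p.1 : ℝ) ≤ x ∧ (x : ℝ) ≤ p.2)}
  have key : ∀ x y : ℝ, 0 ≤ x → x < y → y ≤ 1 → ∃ p : Γ, x ≤ p.1.1 ∧ (p.1.2 : ℝ) ≤ y := by
    intro x y hx hxy hy
    have hd : Dense Aᶜ := (isClosed_isNowhereDense_iff_compl.mp ⟨hA, hn⟩).2
    have hU : IsOpen {t : unitInterval | x < t ∧ (t : ℝ) < y} :=
      (isOpen_lt continuous_const continuous_subtype_val).inter
        (isOpen_lt continuous_subtype_val continuous_const)
    obtain ⟨t, htU, htA⟩ := hd.inter_open_nonempty _ hU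
      ⟨⟨(x + y) / 2, by constructor <;> linarith⟩, by constructor <;> simp <;> linarith⟩
    have hopen : IsOpen (Aᶜ ∩ {t : unitInterval | x < t ∧ (t : ℝ) < y}) := hA.isOpen_compl.inter hU
    obtain ⟨ε, hε, hball⟩ := Metric.isOpen_iff.mp hopen t ⟨htA, htU⟩
    obtain ⟨q', hq1, hq2⟩ := exists_rat_btwn
      (show (t : ℝ) < min y (t + ε) from lt_min htU.2 (by linarith))
    obtain ⟨q, hq3, hq4⟩ := exists_rat_btwn hq1
    have hq2' := lt_min_iff.mp hq2
    have hx0 := htU.1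
    refine ⟨⟨(q, q'), ?_, ?_, ?_, ?_⟩, ?_, hq2'.1.le⟩
    · have : (0 : ℝ) ≤ q := by linarith
      exact_mod_cast this
    · exact_mod_cast hq4
    · have : (q' : ℝ) ≤ 1 := by linarith [hq2'.1]
      exact_mod_cast this
    · rintro s hs ⟨h1, h2⟩
      refine (hball (show s ∈ Metric.ball t ε from ?_)).1 hs
      rw [Metric.mem_ball, Subtype.dist_eq, Real.dist_eq, abs_lt]
      constructor <;> simp at h1 h2 <;> linarith [hq2'.2]
    · exact (hx0.trans hq3).le
  obtain ⟨p0, -⟩ := key 0 1 le_rfl one_pos le_rfl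
  have : Nonempty Γ := ⟨p0⟩
  obtain ⟨e, he⟩ := exists_surjective_nat Γ
  let c : ℕ → ℝ := fun n => 7 * ((8 : ℝ) ^ (n + 1))⁻¹
  let t : ℕ → ℝ → ℝ := fun n x => ramp (e n).1.1 (e n).1.2 x * c n
  have hpos : ∀ n, 0 < c n := fun n => by positivity
  have hc : Summable c := by
    simpa [c] using summable_sparse (fun _ => true)
  have hlt : ∀ n, (((e n).1.1 : ℚ) : ℝ) < ((e n).1.2 : ℚ) := fun n => by
    exact_mod_cast (e n).2.2.1
  have hle : ∀ n x, t n x ≤ c n := fun n x =>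
    mul_le_of_le_one_left (hpos n).le (ramp_mem _ _ _).2
  have h0 : ∀ n x, 0 ≤ t n x := fun n x => mul_nonneg (ramp_mem _ _ _).1 (hpos n).le
  have hs : ∀ x, Summable fun n => t n x := fun x => hc.of_nonneg_of_le (h0 · x) (hle · x)
  have htmono : ∀ n, Monotone (t n) := fun n x y hxy =>
    mul_le_mul_of_nonneg_right (ramp_mono (hlt n) hxy) (hpos n).le
  have hsum : ∑' n, c n = 1 := by
    have := sparsePoint_eq_tsum (fun _ => true)
    rw [sparsePoint_const_true] at this
    simpa [c] using this.symm
  obtain ⟨g, hg⟩ := exists_homeomorph_unitInterval (g := fun x => ∑' n, t n x)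
    (continuous_tsum (fun n => (continuous_ramp _ _).mul continuous_const) hc
      (fun n x => by rw [Real.norm_of_nonneg (h0 n x)]; exact hle n x))
    (by
      intro x hx y hy hxy
      obtain ⟨p, hp1, hp2⟩ := key x y hx.1 hxy hy.2
      obtain ⟨n, rfl⟩ := he p
      refine Summable.tsum_lt_tsum (i := n) (fun k => htmono k hxy.le) ?_ (hs x) (hs y)
      simp only [t]
      rw [ramp_eq_zero (hlt n) hp1, ramp_eq_one (hlt n) hp2]
      simpa using hpos n)
    (by
      have : ∀ n, t n 0 = 0 := fun n => by
        simp only [t]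
        rw [ramp_eq_zero (hlt n) (by exact_mod_cast (e n).2.1), zero_mul]
      simp [this])
    (by
      have : ∀ n, t n 1 = c n := fun n => by
        simp only [t]
        rw [ramp_eq_one (hlt n) (by exact_mod_cast (e n).2.2.2.1), one_mul]
      simp [this, hsum])
  refine ⟨g, fun a ha => ⟨fun n => decide (((e n).1.2 : ℝ) ≤ a), Subtype.ext ?_⟩⟩
  rw [hg, sparsePoint_eq_tsum]
  refine tsum_congr fun n => ?_
  simp only [t, c]
  by_cases h : ((e n).1.2 : ℝ) ≤ a
  · simp [h, ramp_eq_one (hlt n) h]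
  · have h2 : (a : ℝ) ≤ (e n).1.1 := by
      by_contra h3
      exact (e n).2.2.2.2 a ha ⟨(not_le.mp h3).le, (not_le.mp h).le⟩
    simp [h, ramp_eq_zero (hlt n) h2]

/-! ### A homeomorphism of the Hilbert cube pushing points with gaps off the boundary -/

/-- Half the width of the octagon at height `v`. -/
noncomputable def octWidth (v : ℝ) : ℝ := max (3 / 4) (min 1 (5 / 4 - |v| / 2))

/-- Half the height of the octagon at abscissa `u`. -/
noncomputable def octHeight (u : ℝ) : ℝ := max (1 / 2) (min 1 (5 / 2 - 2 * |u|))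

theorem octWidth_le_one (v : ℝ) : octWidth v ≤ 1 := max_le (by norm_num) (min_le_left _ _)

theorem le_octWidth (v : ℝ) : 3 / 4 ≤ octWidth v := le_max_left _ _

theorem octHeight_le_one (v : ℝ) : octHeight v ≤ 1 := max_le (by norm_num) (min_le_left _ _)

theorem le_octHeight (v : ℝ) : 1 / 2 ≤ octHeight v := le_max_left _ _

theorem abs_octWidth_sub_le (v w : ℝ) : |octWidth v - octWidth w| ≤ |v - w| / 2 := by
  unfold octWidth
  refine (abs_max_sub_max_le_max _ _ _ _).trans (max_le (by simp; positivity) ?_)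
  refine (abs_min_sub_min_le_max _ _ _ _).trans (max_le (by simp; positivity) ?_)
  have := abs_abs_sub_abs_le w v
  rw [show 5 / 4 - |v| / 2 - (5 / 4 - |w| / 2) = (|w| - |v|) / 2 by ring, abs_div, abs_two,
    abs_sub_comm v w]
  gcongr

/-- Horizontal and vertical slicing describe the same octagon, with vertices (±1, ±1/2) and (±3/4,
±1). -/
theorem le_octHeight_iff {x y : ℝ} (hx : |x| ≤ 1) (hy : |y| ≤ 1) :
    |x| ≤ octHeight y ↔ |y| ≤ octWidth x := by
  unfold octHeight octWidth
  rw [le_max_iff, le_max_iff, le_min_iff, le_min_iff]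
  constructor
  · rintro (h | ⟨-, h⟩)
    · exact Or.inr ⟨hy, by linarith⟩
    · exact Or.inr ⟨hy, by linarith⟩
  · rintro (h | ⟨-, h⟩)
    · exact Or.inr ⟨hx, by linarith⟩
    · exact Or.inr ⟨hx, by linarith⟩

/-- The states of the transducer that passes from the horizontal to the vertical slicing of the
octagon in each pair of consecutive coordinates. -/
noncomputable def octState (x : ℕ → ℝ) : ℕ → ℝ
  | 0 => x 0
  | n + 1 => x (n + 1) / octHeight (octState x n * octWidth (x (n + 1)))

/-- The output of the transducer. -/
noncomputable def octOut (x : ℕ → ℝ) (n : ℕ) : ℝ := octState x n * octWidth (x (n + 1))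

theorem octState_succ (x : ℕ → ℝ) (n : ℕ) :
    octState x (n + 1) = x (n + 1) / octHeight (octOut x n) := rfl

theorem continuous_octWidth : Continuous octWidth := by unfold octWidth; fun_prop

theorem continuous_octHeight : Continuous octHeight := by unfold octHeight; fun_prop

theorem continuous_octState (n : ℕ) : Continuous fun x => octState x n := by
  induction n with
  | zero => exact continuous_apply 0
  | succ n ih =>
    refine (continuous_apply (n + 1)).div (continuous_octHeight.comp
      (ih.mul (continuous_octWidth.comp (continuous_apply (n + 1))))) fun x => ?_
    have := le_octHeight (octState x n * octWidth (x (n + 1)))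
    exact ne_of_gt (by linarith : 0 < octHeight _)

theorem continuous_octOut : Continuous octOut :=
  continuous_pi fun n =>
    (continuous_octState n).mul (continuous_octWidth.comp (continuous_apply (n + 1)))

/-- Scaling rows maps the square onto the octagon, and dividing by column heights maps the octagon
back onto the square. One step of the transducer is this self-map of the square, from (state, next
input) to (output, next state). -/
theorem abs_octState_le {x : ℕ → ℝ} (hx : ∀ n, |x n| ≤ 1) (n : ℕ) : |octState x n| ≤ 1 := by
  induction n with
  | zero => exact hx 0
  | succ n ih =>
    have h1 := le_octHeight (octOut x n)
    rw [octState_succ, abs_div, abs_of_pos (a := octHeight _) (by linarith),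
      div_le_one (by linarith)]
    have h2 := le_octWidth (x (n + 1))
    have h3 := octWidth_le_one (x (n + 1))
    have h4 : |octOut x n| ≤ octWidth (x (n + 1)) := by
      rw [octOut, abs_mul, abs_of_pos (a := octWidth _) (by linarith)]
      exact mul_le_of_le_one_left (by linarith) ih
    exact (le_octHeight_iff (hx _) (h4.trans h3)).mpr h4

theorem abs_octOut_le {x : ℕ → ℝ} (hx : ∀ n, |x n| ≤ 1) (n : ℕ) :
    |octOut x n| ≤ octWidth (x (n + 1)) := by
  have h2 := le_octWidth (x (n + 1))
  rw [octOut, abs_mul, abs_of_pos (a := octWidth _) (by linarith)]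
  exact mul_le_of_le_one_left (by linarith) (abs_octState_le hx n)

theorem abs_octOut_le_one {x : ℕ → ℝ} (hx : ∀ n, |x n| ≤ 1) (n : ℕ) : |octOut x n| ≤ 1 :=
  (abs_octOut_le hx n).trans (octWidth_le_one _)

/-- For equal outputs the difference of states contracts backwards in time while staying bounded, so
it vanishes; states and outputs determine the inputs. -/
theorem octOut_injOn : InjOn octOut {x | ∀ n, |x n| ≤ 1} := by
  intro x hx y hy hxy
  have hw : ∀ v, 0 < octWidth v := fun v => by linarith [le_octWidth v]
  have hh : ∀ v, 0 < octHeight v := fun v => by linarith [le_octHeight v]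
  have hX : ∀ {x : ℕ → ℝ} n, x (n + 1) = octState x (n + 1) * octHeight (octOut x n) :=
    fun n => by rw [octState_succ, div_mul_cancel₀ _ (hh _).ne']
  -- The width is 1/2-Lipschitz and at least 3/4, and (1/2)/(3/4)² = 8/9.
  have step : ∀ n, |octState x n - octState y n| ≤
      8 / 9 * |octState x (n + 1) - octState y (n + 1)| := by
    intro n
    have e1 : octState x n = octOut x n / octWidth (x (n + 1)) := by
      rw [octOut, mul_div_cancel_right₀ _ (hw _).ne']
    have e2 : octState y n = octOut x n / octWidth (y (n + 1)) := by
      rw [hxy, octOut, mul_div_cancel_right₀ _ (hw _).ne']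
    have h1 : |x (n + 1) - y (n + 1)| ≤ |octState x (n + 1) - octState y (n + 1)| := by
      rw [hX (x := x), hX (x := y), ← hxy, ← sub_mul, abs_mul, abs_of_pos (hh _)]
      exact mul_le_of_le_one_right (abs_nonneg _) (octHeight_le_one _)
    have h2 := abs_octWidth_sub_le (y (n + 1)) (x (n + 1))
    rw [abs_sub_comm (y (n + 1))] at h2
    rw [e1, e2, div_sub_div _ _ (hw _).ne' (hw _).ne', abs_div,
      abs_of_pos (mul_pos (hw _) (hw _)), div_le_iff₀ (mul_pos (hw _) (hw _)),
      mul_comm (octWidth (x (n + 1))) (octOut x n), ← mul_sub, abs_mul]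
    have h3 := abs_octOut_le_one hx n
    have h4 := le_octWidth (x (n + 1))
    have h5 := le_octWidth (y (n + 1))
    have h6 : (9 : ℝ) / 16 ≤ octWidth (x (n + 1)) * octWidth (y (n + 1)) := by nlinarith
    have h7 : |octOut x n| * |octWidth (y (n + 1)) - octWidth (x (n + 1))| ≤
        |octState x (n + 1) - octState y (n + 1)| / 2 :=
      (mul_le_of_le_one_left (abs_nonneg _) h3).trans (by linarith)
    nlinarith [abs_nonneg (octState x (n + 1) - octState y (n + 1))]
  have hpow : ∀ k n, |octState x n - octState y n| ≤ (8 / 9) ^ k * 2 := by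
    intro k
    induction k with
    | zero =>
      intro n
      have := abs_sub (octState x n) (octState y n)
      linarith [abs_octState_le hx n, abs_octState_le hy n]
    | succ k ih =>
      intro n
      calc _ ≤ _ := step n
        _ ≤ 8 / 9 * ((8 / 9) ^ k * 2) := by gcongr; exact ih _
        _ = _ := by ring
  have hstate : ∀ n, octState x n = octState y n := by
    intro n
    have hlim : Tendsto (fun k : ℕ => ((8 : ℝ) / 9) ^ k * 2) atTop (𝓝 (0 * 2)) :=
      (tendsto_pow_atTop_nhds_zero_of_lt_one (by norm_num) (by norm_num)).mul_const 2
    have := ge_of_tendsto' hlim (fun k => hpow k n)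
    rw [zero_mul] at this
    exact sub_eq_zero.mp (abs_nonpos_iff.mp this)
  funext n
  cases n with
  | zero => exact hstate 0
  | succ n => rw [hX (x := x), hX (x := y), hstate, hxy]

/-- A solution for the shifted target supplies the state needed after the first step; inverting that
step on the square gives the first two inputs. -/
theorem exists_octOut_eq (N : ℕ) : ∀ y : ℕ → ℝ, (∀ n, |y n| ≤ 1) →
    ∃ x : ℕ → ℝ, (∀ n, |x n| ≤ 1) ∧ ∀ n < N, octOut x n = y n := by
  induction N with
  | zero => exact fun y _ => ⟨0, by simp, by simp⟩
  | succ N ih =>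
    intro y hy
    obtain ⟨x, hx, hxy⟩ := ih (fun n => y (n + 1)) (fun n => hy _)
    have hh := le_octHeight (y 0)
    set x1 := x 0 * octHeight (y 0) with hx1
    have hw := le_octWidth x1
    have hx1' : |x1| ≤ octHeight (y 0) := by
      rw [hx1, abs_mul, abs_of_pos (a := octHeight _) (by linarith)]
      exact mul_le_of_le_one_left (by linarith) (hx 0)
    have hx1'' : |x1| ≤ 1 := hx1'.trans (octHeight_le_one _)
    let z : ℕ → ℝ := fun n => match n with
      | 0 => y 0 / octWidth x1
      | 1 => x1
      | n + 2 => x (n + 1)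
    have hz0 : octOut z 0 = y 0 := by
      change y 0 / octWidth x1 * octWidth x1 = y 0
      exact div_mul_cancel₀ _ (by linarith)
    have hzs : ∀ n, octState z (n + 1) = octState x n := by
      intro n
      induction n with
      | zero =>
        rw [octState_succ, hz0]
        change x 0 * octHeight (y 0) / octHeight (y 0) = x 0
        exact mul_div_cancel_right₀ _ (by linarith)
      | succ n ih' => rw [octState_succ, octOut, ih', octState_succ, octOut]
    refine ⟨z, fun n => ?_, fun n hn => ?_⟩
    · match n with
      | 0 =>
        change |y 0 / octWidth x1| ≤ 1
        rw [abs_div, abs_of_pos (a := octWidth _) (by linarith), div_le_one (by linarith)]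
        exact (le_octHeight_iff hx1'' (hy 0)).mp hx1'
      | 1 => exact hx1''
      | n + 2 => exact hx (n + 1)
    · cases n with
      | zero => exact hz0
      | succ n => rw [octOut, hzs, ← hxy n (by omega), octOut]

/-- The affine map from the unit interval to `[-1, 1]`, in each coordinate. -/
def symmCube (x : HilbertCube) (n : ℕ) : ℝ := 2 * x n - 1

theorem abs_symmCube_le (x : HilbertCube) (n : ℕ) : |symmCube x n| ≤ 1 := by
  have := (x n).2.1
  have := (x n).2.2
  rw [abs_le, symmCube]
  constructor <;> linarith

/-- The transducer as a map of the Hilbert cube. -/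
noncomputable def octMap (x : HilbertCube) : HilbertCube := fun n =>
  ⟨(octOut (symmCube x) n + 1) / 2, by
    have := abs_le.mp (abs_octOut_le_one (abs_symmCube_le x) n)
    constructor <;> linarith [this.1, this.2]⟩

theorem continuous_symmCube : Continuous symmCube := by unfold symmCube; fun_prop

theorem continuous_octMap : Continuous octMap := by
  refine continuous_pi fun n => Continuous.subtype_mk ?_ _
  have := (continuous_apply n).comp (continuous_octOut.comp continuous_symmCube)
  exact (this.add continuous_const).div_const 2

theorem octMap_bijective : Function.Bijective octMap := by
  constructor
  · intro x y hxy
    have h1 : octOut (symmCube x) = octOut (symmCube y) := by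
      funext n
      have := congrArg Subtype.val (congrFun hxy n)
      simp only [octMap] at this
      linarith
    have h2 := octOut_injOn (abs_symmCube_le x) (abs_symmCube_le y) h1
    funext n
    have := congrFun h2 n
    simp only [symmCube] at this
    exact Subtype.ext (by linarith)
  · intro y
    choose x hx hxy using fun N => exists_octOut_eq N (symmCube y) (abs_symmCube_le y)
    let x' : ℕ → HilbertCube := fun N n => ⟨(x N n + 1) / 2, by
      have := abs_le.mp (hx N n)
      constructor <;> linarith [this.1, this.2]⟩
    have hx' : ∀ N, symmCube (x' N) = x N := fun N => by
      funext n
      simp only [symmCube, x']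
      ring
    -- Every finite prefix of the target is attained; compactness gives the whole target.
    have hcl : IsClosed (range octMap) := (isCompact_range continuous_octMap).isClosed
    change y ∈ range octMap
    rw [← hcl.closure_eq]
    refine mem_closure_of_tendsto (b := atTop) (f := fun N => octMap (x' N)) ?_
      (Eventually.of_forall fun N => mem_range_self (x' N))
    rw [tendsto_pi_nhds]
    intro n
    refine tendsto_const_nhds.congr' ?_
    filter_upwards [eventually_gt_atTop n] with N hN
    apply Subtype.ext
    simp only [octMap, hx', hxy N n hN, symmCube]
    ring

/-- A homeomorphism of the Hilbert cube that moves into the pseudointerior all points whose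
coordinates miss the middle part of the interval. -/
theorem exists_homeomorph_into_interior :
    ∃ h : HilbertCube ≃ₜ HilbertCube,
      (∀ x : HilbertCube, (∀ n, (x n : ℝ) ≤ 1 / 8 ∨ 7 / 8 ≤ (x n : ℝ)) →
        ∀ n, 0 < (h x n : ℝ) ∧ (h x n : ℝ) < 1) ∧
      ∀ x : HilbertCube, (∀ n, x n = 0 ∨ x n = 1) →
        ∀ n, (h x n : ℝ) = 1 / 8 ∨ (h x n : ℝ) = 7 / 8 := by
  obtain ⟨h, hh⟩ := exists_homeomorph_of_bijective continuous_octMap octMap_bijective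
  refine ⟨h, fun x hx n => ?_, fun x hx n => ?_⟩
  · rw [hh]
    have h1 : |octOut (symmCube x) n| < 1 := by
      refine (abs_octOut_le (abs_symmCube_le x) n).trans_lt ?_
      -- At such heights the octagon is strictly narrower than the square.
      have h2 : 3 / 4 ≤ |symmCube x (n + 1)| := by
        rw [le_abs, symmCube]
        rcases hx (n + 1) with h | h
        · right; linarith
        · left; linarith
      exact max_lt (by norm_num) (min_lt_of_right_lt (by linarith))
    rw [abs_lt] at h1
    simp only [octMap]
    constructor <;> linarith [h1.1, h1.2]
  · rw [hh]
    have h1 : ∀ n, |symmCube x n| = 1 := fun n => by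
      rw [symmCube]
      rcases hx n with h | h <;> rw [h] <;> norm_num
    have h2 : ∀ v : ℝ, |v| = 1 → octWidth v = 3 / 4 := fun v hv => by
      rw [octWidth, hv]; norm_num
    have h3 : ∀ v : ℝ, |v| = 3 / 4 → octHeight v = 1 := fun v hv => by
      rw [octHeight, hv]; norm_num
    -- At height ±1 the half-width is 3/4, and at abscissa ±3/4 the half-height is still 1. So the
    -- state stays ±1 and the output is ±3/4.
    have h4 : ∀ n, |octState (symmCube x) n| = 1 := by
      intro n
      induction n with
      | zero => exact h1 0
      | succ n ih =>
        rw [octState_succ, octOut, h2 _ (h1 _), h3, div_one, h1]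
        rw [abs_mul, ih]
        norm_num
    simp only [octMap, octOut, h2 _ (h1 _)]
    rcases eq_or_eq_neg_of_abs_eq (h4 n) with h | h <;> rw [h] <;> norm_num

/-! ### Straightening graphs over compact sets -/

/-- Multiplication of the odds `y / (1 - y)` by `exp l`. -/
noncomputable def oddsMul (l : ℝ) (y : unitInterval) : unitInterval :=
  ⟨Real.exp l * y / (Real.exp l * y + (1 - y)), by
    have h1 := y.2.1
    have h2 : (0 : ℝ) ≤ 1 - y := sub_nonneg.mpr y.2.2
    have h3 := Real.exp_pos l
    exact ⟨by positivity, div_le_one_of_le₀ (by linarith) (by positivity)⟩⟩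

theorem oddsMul_denom_pos (l : ℝ) (y : unitInterval) : 0 < Real.exp l * y + (1 - y) := by
  have h1 := y.2.1
  have h2 : (0 : ℝ) ≤ 1 - y := sub_nonneg.mpr y.2.2
  have h3 := Real.exp_pos l
  rcases h1.eq_or_lt with h | h
  · rw [← h]; norm_num
  · have := mul_pos h3 h
    linarith

theorem oddsMul_oddsMul (l m : ℝ) (y : unitInterval) :
    oddsMul l (oddsMul m y) = oddsMul (l + m) y := by
  apply Subtype.ext
  have h1 := oddsMul_denom_pos m y
  have h2 := oddsMul_denom_pos (l + m) y
  have h3 := oddsMul_denom_pos l (oddsMul m y)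
  simp only [oddsMul] at h3 ⊢
  rw [div_eq_div_iff h3.ne' h2.ne', Real.exp_add]
  field_simp
  ring

theorem oddsMul_zero (y : unitInterval) : oddsMul 0 y = y := by
  apply Subtype.ext
  simp [oddsMul]

/-- The action is transitive on the open interval, the parameter being the difference of log-odds.
-/
theorem oddsMul_log {u v : unitInterval} (hu : 0 < (u : ℝ) ∧ (u : ℝ) < 1)
    (hv : 0 < (v : ℝ) ∧ (v : ℝ) < 1) :
    oddsMul (Real.log (v * (1 - u)) - Real.log (u * (1 - v))) u = v := by
  apply Subtype.ext
  have h1 : 0 < 1 - (u : ℝ) := by linarith [hu.2]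
  have h2 : 0 < 1 - (v : ℝ) := by linarith [hv.2]
  have h3 := oddsMul_denom_pos (Real.log (v * (1 - u)) - Real.log (u * (1 - v))) u
  simp only [oddsMul]
  rw [div_eq_iff h3.ne', Real.exp_sub, Real.exp_log (mul_pos hv.1 h1),
    Real.exp_log (mul_pos hu.1 h2)]
  have := hu.1
  field_simp
  ring

theorem continuous_oddsMul : Continuous fun z : ℝ × unitInterval => oddsMul z.1 z.2 := by
  refine Continuous.subtype_mk (f := fun z : ℝ × unitInterval =>
    Real.exp z.1 * z.2 / (Real.exp z.1 * z.2 + (1 - z.2))) ?_ _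
  exact Continuous.div (by fun_prop) (by fun_prop) fun z => (oddsMul_denom_pos z.1 z.2).ne'

/-- The homeomorphism of `X × Q` that multiplies the odds of the coordinates in the fibre
over `x` by `exp (L x)`. -/
noncomputable def fibreOdds {X : Type*} [TopologicalSpace X] (L : C(X, ℕ → ℝ)) :
    X × HilbertCube ≃ₜ X × HilbertCube where
  toFun z := (z.1, fun n => oddsMul (L z.1 n) (z.2 n))
  invFun z := (z.1, fun n => oddsMul (-L z.1 n) (z.2 n))
  left_inv z := by simp [oddsMul_oddsMul, oddsMul_zero]
  right_inv z := by simp [oddsMul_oddsMul, oddsMul_zero]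
  continuous_toFun := by
    refine continuous_fst.prodMk (continuous_pi fun n => continuous_oddsMul.comp
      (f := fun z : X × HilbertCube => (L z.1 n, z.2 n)) ?_)
    fun_prop
  continuous_invFun := by
    refine continuous_fst.prodMk (continuous_pi fun n => continuous_oddsMul.comp
      (f := fun z : X × HilbertCube => (-L z.1 n, z.2 n)) ?_)
    fun_prop

/-- A graph over a compact set, with values in the pseudointerior, can be moved fibrewise to any
other such graph. -/
theorem exists_homeomorph_graph {K X : Type} [TopologicalSpace K] [CompactSpace K]
    [TopologicalSpace X] [NormalSpace X] [T2Space X] {p : K → X} (hp : Continuous p)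
    (hpi : Function.Injective p) {u v : K → HilbertCube} (hu : Continuous u) (hv : Continuous v)
    (hu' : ∀ k n, 0 < (u k n : ℝ) ∧ (u k n : ℝ) < 1)
    (hv' : ∀ k n, 0 < (v k n : ℝ) ∧ (v k n : ℝ) < 1) :
    ∃ Φ : X × HilbertCube ≃ₜ X × HilbertCube, ∀ k, Φ (p k, u k) = (p k, v k) := by
  have h1 : ∀ k n, 0 < (v k n : ℝ) * (1 - u k n) := fun k n =>
    mul_pos (hv' k n).1 (by linarith [(hu' k n).2])
  have h2 : ∀ k n, 0 < (u k n : ℝ) * (1 - v k n) := fun k n =>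
    mul_pos (hu' k n).1 (by linarith [(hv' k n).2])
  -- The parameters required over the compact set are continuous because all values are interior;
  -- Tietze extends them over `X`.
  let ℓ : C(K, ℕ → ℝ) := ⟨fun k n =>
    Real.log (v k n * (1 - u k n)) - Real.log (u k n * (1 - v k n)), by
      refine continuous_pi fun n => ?_
      refine (Continuous.log (by fun_prop) fun k => (h1 k n).ne').sub
        (Continuous.log (by fun_prop) fun k => (h2 k n).ne')⟩
  obtain ⟨L, hL⟩ := ℓ.exists_extension (hp.isClosedEmbedding hpi)
  refine ⟨fibreOdds L, fun k => Prod.ext rfl (funext fun n => ?_)⟩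
  have : L (p k) = ℓ k := congrArg (fun g : C(K, ℕ → ℝ) => g k) hL
  change oddsMul (L (p k) n) (u k n) = v k n
  rw [this]
  exact oddsMul_log (hu' k n) (hv' k n)

/-! ### Shears -/

/-- The shift by `β` away from the end-points of the interval. -/
noncomputable def shear (M β y : ℝ) : ℝ := y + β * min 1 (min (M * y) (M * (1 - y)))

theorem continuous_shear (M : ℝ) : Continuous fun z : ℝ × ℝ => shear M z.1 z.2 := by
  unfold shear
  fun_prop

/-- The truncated tent has slope at least `-M`, so a slope of at least 1/2 remains. -/
theorem shear_strictMono {M β : ℝ} (hM : 0 < M) (hβ : 0 ≤ β) (h : β * M ≤ 1 / 2) :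
    StrictMono (shear M β) := by
  intro x y hxy
  have key : min 1 (min (M * x) (M * (1 - x))) - min 1 (min (M * y) (M * (1 - y))) ≤
      M * (y - x) := by
    have h0 : 0 ≤ M * (y - x) := mul_nonneg hM.le (by linarith)
    rw [sub_le_iff_le_add, ← min_add_add_left, ← min_add_add_left]
    refine le_min ((min_le_left _ _).trans (by linarith)) (le_min ?_ ?_)
    · exact (min_le_right _ _).trans ((min_le_left _ _).trans (by nlinarith))
    · exact (min_le_right _ _).trans ((min_le_right _ _).trans (by nlinarith))
  have := mul_le_mul_of_nonneg_left key hβ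
  unfold shear
  nlinarith

theorem exists_homeomorph_shear {M β : ℝ} (hM : 0 < M) (hβ : 0 ≤ β) (h : β * M ≤ 1 / 2) :
    ∃ g : unitInterval ≃ₜ unitInterval, ∀ x, (g x : ℝ) = shear M β x := by
  refine exists_homeomorph_unitInterval
    ((continuous_shear M).comp (continuous_const.prodMk continuous_id))
    ((shear_strictMono hM hβ h).strictMonoOn _) ?_ ?_
  · simp [shear, hM.le]
  · simp [shear, hM.le]

theorem shear_eq_add {M β y : ℝ} (h0 : 1 ≤ M * y) (h1 : 1 ≤ M * (1 - y)) :
    shear M β y = y + β := by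
  rw [shear, min_eq_left (le_min h0 h1), mul_one]

/-- The homeomorphism of `Q × Q` that shears the first coordinate of the first factor by a function
of the second factor. -/
theorem exists_homeomorph_fibre_shear {M : ℝ} (hM : 0 < M) (B : C(HilbertCube, ℝ))
    (hB : ∀ b, 0 ≤ B b ∧ B b * M ≤ 1 / 2) :
    ∃ Φ : HilbertCube × HilbertCube ≃ₜ HilbertCube × HilbertCube, ∀ a b,
      (Φ (a, b)).2 = b ∧ ((Φ (a, b)).1 0 : ℝ) = shear M (B b) (a 0) ∧
        ∀ n, (Φ (a, b)).1 (n + 1) = a (n + 1) := by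
  choose g hg using fun b => exists_homeomorph_shear hM (hB b).1 (hB b).2
  let F : HilbertCube × HilbertCube → HilbertCube × HilbertCube := fun z =>
    (fun n => if n = 0 then g z.2 (z.1 0) else z.1 n, z.2)
  have hFc : Continuous F := by
    refine Continuous.prodMk (continuous_pi fun n => ?_) continuous_snd
    by_cases hn : n = 0
    · simp only [hn, if_true]
      rw [continuous_induced_rng]
      refine ((continuous_shear M).comp (f := fun z : HilbertCube × HilbertCube =>
        (B z.2, (z.1 0 : ℝ))) (by fun_prop)).congr fun z => ?_
      simp [hg]
    · simp only [hn, if_false]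
      fun_prop
  have hFb : Function.Bijective F := by
    constructor
    · rintro ⟨a, b⟩ ⟨a', b'⟩ h
      obtain rfl : b = b' := congrArg Prod.snd h
      refine Prod.ext (funext fun n => ?_) rfl
      have hn := congrFun (congrArg Prod.fst h) n
      by_cases h0 : n = 0
      · subst h0
        simpa [F] using hn
      · simpa [F, h0] using hn
    · rintro ⟨a, b⟩
      refine ⟨(fun n => if n = 0 then (g b).symm (a 0) else a n, b),
        Prod.ext (funext fun n => ?_) rfl⟩
      by_cases h0 : n = 0
      · subst h0
        simp [F]
      · simp [F, h0]
  obtain ⟨Φ, hΦ⟩ := exists_homeomorph_of_bijective hFc hFb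
  refine ⟨Φ, fun a b => ⟨?_, ?_, fun n => ?_⟩⟩ <;> rw [hΦ]
  · simp [F, hg]
  · simp [F]

/-! ### Standard position of Cantor sets in the Hilbert cube -/

/-- Splitting off the first coordinate of the Hilbert cube. -/
def consHomeo : unitInterval × HilbertCube ≃ₜ HilbertCube where
  toFun z n := Nat.casesOn n z.1 z.2
  invFun x := (x 0, fun n => x (n + 1))
  left_inv _ := rfl
  right_inv x := by
    funext n
    cases n <;> rfl
  continuous_toFun := continuous_pi fun n => by
    cases n
    · exact continuous_fst
    · exact (continuous_apply _).comp continuous_snd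
  continuous_invFun := by fun_prop

/-- Splitting the coordinates of the Hilbert cube into the even and the odd ones. -/
def evenOddHomeo : HilbertCube ≃ₜ HilbertCube × HilbertCube where
  toFun x := (fun n => x (Equiv.natSumNatEquivNat (Sum.inl n)),
    fun n => x (Equiv.natSumNatEquivNat (Sum.inr n)))
  invFun z n := Sum.elim z.1 z.2 (Equiv.natSumNatEquivNat.symm n)
  left_inv x := by
    funext n
    obtain ⟨m | m, rfl⟩ := Equiv.natSumNatEquivNat.surjective n <;> simp
  right_inv z := by simp
  continuous_toFun := by fun_prop
  continuous_invFun := continuous_pi fun n => by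
    rcases Equiv.natSumNatEquivNat.symm n with m | m
    · exact (continuous_apply m).comp continuous_fst
    · exact (continuous_apply m).comp continuous_snd

/-- The homeomorphism of the Hilbert cube given by a permutation of the coordinates. -/
def permHomeo (σ : Equiv.Perm ℕ) : HilbertCube ≃ₜ HilbertCube where
  toFun x n := x (σ n)
  invFun x n := x (σ.symm n)
  left_inv x := by simp
  right_inv x := by simp
  continuous_toFun := by fun_prop
  continuous_invFun := by fun_prop

/-- The mid-point of the interval. -/
noncomputable def midpointI : unitInterval := ⟨1 / 2, by norm_num, by norm_num⟩

/-- An embedding of the Cantor cube into the pseudointerior of the Hilbert cube. -/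
noncomputable def thirdsPoint (c : ℕ → Bool) : HilbertCube := fun n =>
  if c n then ⟨2 / 3, by norm_num, by norm_num⟩ else ⟨1 / 3, by norm_num, by norm_num⟩

theorem continuous_thirdsPoint : Continuous thirdsPoint :=
  continuous_pi fun n => (continuous_of_discreteTopology (f := fun b : Bool => if b then
    (⟨2 / 3, by norm_num, by norm_num⟩ : unitInterval) else
      ⟨1 / 3, by norm_num, by norm_num⟩)).comp (continuous_apply n)

theorem thirdsPoint_injective : Function.Injective thirdsPoint := by
  intro c d h
  funext n
  have := congrArg Subtype.val (congrFun h n)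
  simp only [thirdsPoint] at this
  revert this
  cases c n <;> cases d n <;> norm_num

theorem thirdsPoint_mem (c : ℕ → Bool) (n : ℕ) :
    0 < (thirdsPoint c n : ℝ) ∧ (thirdsPoint c n : ℝ) < 1 := by
  simp only [thirdsPoint]
  cases c n <;> norm_num

/-- An embedding of the Cantor cube is standard if a homeomorphism of the Hilbert cube takes it
to a fixed embedding. -/
def IsStandard (f : (ℕ → Bool) → HilbertCube) : Prop :=
  ∃ h : HilbertCube ≃ₜ HilbertCube, ∀ c,
    h (f c) = evenOddHomeo.symm (fun _ => midpointI, thirdsPoint c)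

/-- The embedding of the space of arrays of bits into the Hilbert cube by sparse points. -/
noncomputable def sparseCube (v : ℕ → ℕ → Bool) : HilbertCube := fun n => sparsePoint (v n)

theorem continuous_sparseCube : Continuous sparseCube :=
  continuous_pi fun n => continuous_sparsePoint.comp (continuous_apply n)

theorem sparseCube_injective : Function.Injective sparseCube := fun _ _ h =>
  funext fun n => sparsePoint_injective (congrFun h n)

theorem exists_homeomorph_tail (h : HilbertCube ≃ₜ HilbertCube) :
    ∃ g : HilbertCube ≃ₜ HilbertCube, ∀ x, g x 0 = x 0 ∧
      ∀ n, g x (n + 1) = h (fun k => x (k + 1)) n :=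
  ⟨consHomeo.symm.trans (((Homeomorph.refl _).prodCongr h).trans consHomeo),
    fun _ => ⟨rfl, fun _ => rfl⟩⟩

/-- Klee's trick used twice. A shear adds a code of the second component to coordinate 0 of the
first, which becomes an injective function of `c`. Over it the second component is moved to
`thirdsPoint c`; then, with the roles exchanged, the first is moved to a constant. -/
theorem exists_homeomorph_sparse_pair {α β : (ℕ → Bool) → ℕ → ℕ → Bool} {N : ℕ}
    (hα : Continuous fun c => sparseCube (α c)) (hβ : Continuous fun c => sparseCube (β c))
    (hinj : ∀ c d, α c = α d → β c = β d → c = d)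
    (hj : ∀ c, ∃ j < N, α c 0 j = false) (hk : ∀ c, ∃ k < N, α c 0 k = true) :
    ∃ Φ : HilbertCube × HilbertCube ≃ₜ HilbertCube × HilbertCube, ∀ c,
      Φ (sparseCube (α c), sparseCube (β c)) = (fun _ => midpointI, thirdsPoint c) := by
  obtain ⟨h, hh, -⟩ := exists_homeomorph_into_interior
  set M : ℝ := (8 : ℝ) ^ N with hM
  have hMpos : 0 < M := by positivity
  -- The array is packed into one bit sequence, delayed by `N` places so that its value is at most
  -- `8^(-N)` and half of it fits into the room left at coordinate 0.
  let σ : (ℕ → ℕ → Bool) → ℕ → Bool := fun v n =>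
    if n < N then false else v (Nat.unpair (n - N)).1 (Nat.unpair (n - N)).2
  have hσinj : Function.Injective σ := by
    intro v w hvw
    funext n m
    have := congrFun hvw (Nat.pair n m + N)
    simpa [σ] using this
  have hσc : Continuous σ := by
    refine continuous_pi fun n => ?_
    by_cases hn : n < N
    · simp only [σ, hn, if_true]
      exact continuous_const
    · simp only [σ, hn, if_false]
      fun_prop
  have hσle : ∀ v, (sparsePoint (σ v) : ℝ) ≤ M⁻¹ := fun v =>
    sparsePoint_le_of_false fun n hn => by simp [σ, hn]
  let s : C(ℕ → ℕ → Bool, ℝ) := ⟨fun v => sparsePoint (σ v) / 2,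
    (continuous_subtype_val.comp (continuous_sparsePoint.comp hσc)).div_const 2⟩
  obtain ⟨B, hBmem, hBs⟩ := s.exists_extension_forall_mem_of_isClosedEmbedding
    (t := Icc 0 (M⁻¹ / 2))
    (fun v => ⟨div_nonneg (sparsePoint (σ v)).2.1 two_pos.le,
      div_le_div_of_nonneg_right (hσle v) two_pos.le⟩) ⟨0, le_rfl, by positivity⟩
    (continuous_sparseCube.isClosedEmbedding sparseCube_injective)
  have hB : ∀ v, B (sparseCube v) = sparsePoint (σ v) / 2 := fun v => congrFun hBs v
  obtain ⟨Φ₁, hΦ₁⟩ := exists_homeomorph_fibre_shear hMpos B fun b => ⟨(hBmem b).1, by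
    have := mul_le_mul_of_nonneg_right (hBmem b).2 hMpos.le
    rwa [div_mul_eq_mul_div, inv_mul_cancel₀ hMpos.ne'] at this⟩
  -- Coordinate 0 of the sheared point is already interior; only the tail has to be pushed off the
  -- boundary.
  obtain ⟨g, hg⟩ := exists_homeomorph_tail h
  let p : (ℕ → Bool) → HilbertCube := fun c =>
    (Φ₁ (sparseCube (α c), sparseCube (β c))).1
  have hpow : ∀ i, i < N → M⁻¹ ≤ ((8 : ℝ) ^ (i + 1))⁻¹ := fun i hi =>
    inv_anti₀ (by positivity) (pow_le_pow_right₀ (by norm_num) (by omega))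
  have hlow : ∀ c, M⁻¹ ≤ (sparsePoint (α c 0) : ℝ) := fun c => by
    obtain ⟨k, hkN, hk'⟩ := hk c
    exact (hpow k hkN).trans (le_sparsePoint_of_true hk')
  have hupp : ∀ c, (sparsePoint (α c 0) : ℝ) ≤ 1 - M⁻¹ := fun c => by
    obtain ⟨j, hjN, hj'⟩ := hj c
    linarith [sparsePoint_le_of_eq_false hj', hpow j hjN]
  have hp0 : ∀ c, (p c 0 : ℝ) = sparsePoint (α c 0) + sparsePoint (σ (β c)) / 2 := fun c => by
    rw [(hΦ₁ _ _).2.1, shear_eq_add, hB]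
    · rfl
    · have := mul_le_mul_of_nonneg_left (hlow c) hMpos.le
      rwa [mul_inv_cancel₀ hMpos.ne'] at this
    · have := mul_le_mul_of_nonneg_left (hlow c) hMpos.le
      have h2 := mul_le_mul_of_nonneg_left (hupp c) hMpos.le
      rw [mul_sub, mul_inv_cancel₀ hMpos.ne'] at h2
      change 1 ≤ M * (1 - (sparsePoint (α c 0) : ℝ))
      linarith
  have hps : ∀ c n, p c (n + 1) = sparsePoint (α c (n + 1)) := fun c n => (hΦ₁ _ _).2.2 n
  have hΦ₁p : ∀ c, Φ₁ (sparseCube (α c), sparseCube (β c)) = (p c, sparseCube (β c)) := fun c =>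
    Prod.ext rfl (hΦ₁ _ _).1
  have hpc : Continuous p := continuous_fst.comp (Φ₁.continuous.comp (hα.prodMk hβ))
  have hpinj : Function.Injective p := by
    intro c d hcd
    have h0 := congrArg Subtype.val (congrFun hcd 0)
    rw [hp0, hp0] at h0
    obtain ⟨h1, h2⟩ := sparsePoint_add_half_injective h0
    refine hinj c d (funext fun n => ?_) (hσinj h2)
    cases n with
    | zero => exact h1
    | succ n =>
      have := congrFun hcd (n + 1)
      rw [hps, hps] at this
      exact sparsePoint_injective this
  have hMi : 0 < M⁻¹ := by positivity
  obtain ⟨Φ₂, hΦ₂⟩ := exists_homeomorph_graph (g.continuous.comp hpc)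
    (g.injective.comp hpinj) (h.continuous.comp hβ) continuous_thirdsPoint
    (fun c => hh _ fun n => sparsePoint_gap (β c n)) thirdsPoint_mem
  obtain ⟨Φ₃, hΦ₃⟩ := exists_homeomorph_graph continuous_thirdsPoint thirdsPoint_injective
    (g.continuous.comp hpc) (v := fun _ _ => midpointI) continuous_const
    (by
      intro c n
      cases n with
      | zero =>
        have h1 := (sparsePoint (σ (β c))).2.1
        have h2 := hσle (β c)
        simp only [Function.comp]
        rw [(hg _).1, hp0]
        constructor <;> linarith [hlow c, hupp c]
      | succ n =>
        simp only [Function.comp]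
        rw [(hg _).2]
        refine hh _ (fun n => ?_) n
        rw [hps]
        exact sparsePoint_gap _)
    (fun _ _ => by simp only [midpointI]; norm_num)
  refine ⟨Φ₁.trans ((g.prodCongr h).trans (Φ₂.trans ((Homeomorph.prodComm _ _).trans
    (Φ₃.trans (Homeomorph.prodComm _ _))))), fun c => ?_⟩
  simp only [Homeomorph.trans_apply]
  rw [hΦ₁p]
  have e1 : (g.prodCongr h) (p c, sparseCube (β c)) = ((g ∘ p) c, h (sparseCube (β c))) := rfl
  rw [e1]
  have e2 := hΦ₂ c
  simp only [Function.comp] at e2 ⊢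
  rw [e2]
  have e3 := hΦ₃ c
  simp only [Function.comp] at e3
  change (Homeomorph.prodComm _ _) (Φ₃ (thirdsPoint c, g (p c))) = _
  rw [e3]
  rfl

theorem isStandard_of_sparse {f : (ℕ → Bool) → HilbertCube} (hf : Continuous f)
    (hinj : Function.Injective f) {α : (ℕ → Bool) → ℕ → ℕ → Bool}
    (hα : ∀ c, f c = sparseCube (α c)) {i N : ℕ}
    (hj : ∀ c, ∃ j < N, α c i j = false) (hk : ∀ c, ∃ k < N, α c i k = true) : IsStandard f := by
  let σ := Equiv.swap 0 i
  have hc : Continuous fun c => evenOddHomeo (permHomeo σ (f c)) :=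
    evenOddHomeo.continuous.comp ((permHomeo σ).continuous.comp hf)
  let e := Equiv.natSumNatEquivNat
  have he : ∀ c, evenOddHomeo (permHomeo σ (f c)) =
      (sparseCube fun n => α c (σ (e (Sum.inl n))), sparseCube fun n => α c (σ (e (Sum.inr n)))) :=
    fun c => by rw [hα]; rfl
  have h0 : σ (e (Sum.inl 0)) = i := by simp [e, σ]
  simp only [he] at hc
  obtain ⟨Φ, hΦ⟩ := exists_homeomorph_sparse_pair (continuous_fst.comp hc) (continuous_snd.comp hc)
    (N := N)
    (fun c d h1 h2 => hinj (by
      apply (permHomeo σ).injective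
      apply evenOddHomeo.injective
      rw [he, he, h1, h2]))
    (fun c => by rw [h0]; exact hj c) (fun c => by rw [h0]; exact hk c)
  refine ⟨(permHomeo σ).trans (evenOddHomeo.trans (Φ.trans evenOddHomeo.symm)), fun c => ?_⟩
  simp only [Homeomorph.trans_apply]
  rw [he, hΦ]

theorem IsStandard.of_comp {f : (ℕ → Bool) → HilbertCube} (g : HilbertCube ≃ₜ HilbertCube)
    (h : IsStandard fun c => g (f c)) : IsStandard f := by
  obtain ⟨φ, hφ⟩ := h
  exact ⟨g.trans φ, hφ⟩

theorem sparsePoint_first : (sparsePoint fun n => decide (n = 0) : ℝ) = 7 / 8 := by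
  rw [sparsePoint_eq_tsum, tsum_eq_single 0 (fun n hn => by simp [hn])]
  norm_num

/-- The rows of a corner are constant, so no coordinate has both digits. Moving the coordinates to
1/8 and 7/8, with expansions 0777… and 7000…, puts both digits into the first two places. -/
theorem isStandard_of_corners {f : (ℕ → Bool) → HilbertCube} (hf : Continuous f)
    (hinj : Function.Injective f) (hc : ∀ c n, f c n = 0 ∨ f c n = 1) : IsStandard f := by
  obtain ⟨h, -, hh⟩ := exists_homeomorph_into_interior
  refine IsStandard.of_comp h ?_
  have key : ∀ c n, ∃ e : ℕ → Bool, h (f c) n = sparsePoint e ∧ (∃ j < 2, e j = false) ∧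
      ∃ k < 2, e k = true := by
    intro c n
    rcases hh (f c) (hc c) n with h1 | h1
    · refine ⟨fun n => !decide (n = 0), Subtype.ext ?_, ⟨0, by simp⟩, ⟨1, by simp⟩⟩
      rw [h1, sparsePoint_not, sparsePoint_first]
      norm_num
    · refine ⟨fun n => decide (n = 0), Subtype.ext ?_, ⟨1, by simp⟩, ⟨0, by simp⟩⟩
      rw [h1, sparsePoint_first]
  choose α h1 h2 h3 using key
  exact isStandard_of_sparse (i := 0) (h.continuous.comp hf) (h.injective.comp hinj)
    (α := α) (fun c => funext (h1 c)) (fun c => h2 c 0) (fun c => h3 c 0)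

/-! ### Cantor sets -/

theorem isCantorSet_range {X : Type*} [TopologicalSpace X] [T2Space X] {f : (ℕ → Bool) → X}
    (hf : Continuous f) (hinj : Function.Injective f) : IsCantorSet (range f) :=
  ⟨((hf.isClosedEmbedding hinj).isEmbedding.toHomeomorph).symm⟩

theorem IsCantorSet.exists_param {X : Type*} [TopologicalSpace X] {A : Set X}
    (hA : IsCantorSet A) :
    ∃ f : (ℕ → Bool) → X, Continuous f ∧ Function.Injective f ∧ range f = A := by
  obtain ⟨e⟩ := hA
  refine ⟨fun c => e.symm c, continuous_subtype_val.comp e.symm.continuous,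
    Subtype.val_injective.comp e.symm.injective, ?_⟩
  ext x
  constructor
  · rintro ⟨c, rfl⟩
    exact (e.symm c).2
  · exact fun hx => ⟨e ⟨x, hx⟩, by simp⟩

theorem IsCantorSet.isCompact {X : Type*} [TopologicalSpace X] {A : Set X}
    (hA : IsCantorSet A) : IsCompact A := by
  obtain ⟨f, hf, -, rfl⟩ := hA.exists_param
  exact isCompact_range hf

theorem not_countable_cantorCube : ¬ Countable (ℕ → Bool) := by
  rw [← Cardinal.mk_le_aleph0_iff, not_le]
  simpa using Cardinal.cantor Cardinal.aleph0

theorem IsCantorSet.not_countable {X : Type*} [TopologicalSpace X] {A : Set X}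
    (hA : IsCantorSet A) : ¬ A.Countable := by
  obtain ⟨e⟩ := hA
  intro h
  have : Countable A := h
  exact not_countable_cantorCube e.symm.injective.countable

/-! ### Uncountable parts with nowhere dense coordinate projections -/

open MeasureTheory

/-- There are only countably many atoms, so some countable dense set is null; remove an open
neighbourhood of it of small measure. -/
theorem exists_isClosed_isNowhereDense_measure_compl_lt (ν : Measure unitInterval)
    [IsFiniteMeasure ν] {ε : ENNReal} (hε : ε ≠ 0) :
    ∃ A : Set unitInterval, IsClosed A ∧ IsNowhereDense A ∧ ν Aᶜ < ε := by
  have hat : {x : unitInterval | 0 < ν {x}}.Countable :=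
    Measure.countable_meas_pos_of_disjoint_iUnion (fun x => measurableSet_singleton x)
      fun x y hxy => by simpa [Function.onFun] using hxy
  have hd : Dense {x : unitInterval | 0 < ν {x}}ᶜ := by
    have : {x : unitInterval | 0 < ν {x}}ᶜ = ⋂ x ∈ {x : unitInterval | 0 < ν {x}}, {x}ᶜ := by
      ext y
      simp only [mem_compl_iff, mem_iInter, mem_singleton_iff, mem_ofPred_eq]
      exact ⟨fun h i hi hyi => h (hyi ▸ hi), fun h hy => h y hy rfl⟩
    rw [this]
    exact dense_biInter_of_isOpen (fun x _ => isOpen_compl_singleton) hat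
      fun x _ => dense_compl_singleton x
  obtain ⟨D, hDs, hDc, hDd⟩ := hd.exists_countable_dense_subset
  have hD0 : ν D = 0 := by
    rw [← biUnion_of_singleton D, measure_biUnion_null_iff hDc]
    intro x hx
    simpa using hDs hx
  obtain ⟨U, hDU, hUo, hU⟩ := D.exists_isOpen_lt_of_lt ε (by rw [hD0]; exact hε.bot_lt)
  exact ⟨Uᶜ, hUo.isClosed_compl, (isClosed_isNowhereDense_iff_compl.mpr
    ⟨by simpa using hUo, by simpa using hDd.mono hDU⟩).2, by simpa using hU⟩

/-- Lebesgue measure is carried to `B` by a Borel isomorphism. If the coordinate conditions together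
lose mass less than 1, the remaining part has positive measure and is uncountable. -/
theorem exists_pi_inter_not_countable {B : Set HilbertCube} (hB : IsClosed B)
    (hBc : ¬ B.Countable) :
    ∃ A : ℕ → Set unitInterval, (∀ n, IsClosed (A n)) ∧ (∀ n, IsNowhereDense (A n)) ∧
      ¬ (B ∩ {x | ∀ n, x n ∈ A n}).Countable := by
  have : StandardBorelSpace B := hB.measurableSet.standardBorel
  have hI : ¬ Countable unitInterval := by
    rw [← Cardinal.mk_le_aleph0_iff, Cardinal.mk_Icc_real one_pos, not_le]
    exact Cardinal.aleph0_lt_continuum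
  let e : B ≃ᵐ unitInterval := PolishSpace.measurableEquivOfNotCountable hBc hI
  let j : unitInterval → HilbertCube := fun t => e.symm t
  have hj : Measurable j := measurable_subtype_coe.comp e.symm.measurable
  have hji : Function.Injective j := Subtype.val_injective.comp e.symm.injective
  let ν : ℕ → Measure unitInterval := fun n => (volume : Measure unitInterval).map fun t => j t n
  have hjn : ∀ n, Measurable fun t => j t n := fun n => (measurable_pi_apply n).comp hj
  have : ∀ n, IsProbabilityMeasure (ν n) := fun n =>
    Measure.isProbabilityMeasure_map (hjn n).aemeasurable
  obtain ⟨ε, hε, hsum⟩ := ENNReal.exists_pos_sum_of_countable' (ε := 1) one_ne_zero ℕ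
  choose A hA hAn hAν using fun n =>
    exists_isClosed_isNowhereDense_measure_compl_lt (ν n) (hε n).ne'
  refine ⟨A, hA, hAn, fun hc => ?_⟩
  have h0 : (volume : Measure unitInterval) (j ⁻¹' (B ∩ {x | ∀ n, x n ∈ A n})) = 0 :=
    (hc.preimage hji).measure_zero _
  have h1 : (volume : Measure unitInterval) (j ⁻¹' (B ∩ {x | ∀ n, x n ∈ A n}))ᶜ < 1 := by
    refine lt_of_le_of_lt (measure_mono (t := ⋃ n, (fun t => j t n) ⁻¹' (A n)ᶜ) ?_) ?_
    · intro t ht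
      by_contra h
      simp only [mem_iUnion, mem_preimage, mem_compl_iff, not_exists, not_not] at h
      exact ht ⟨(e.symm t).2, h⟩
    · refine lt_of_le_of_lt (measure_iUnion_le _) (lt_of_le_of_lt ?_ hsum)
      refine ENNReal.tsum_le_tsum fun n => ?_
      rw [← Measure.map_apply (hjn n) (hA n).measurableSet.compl]
      exact (hAν n).le
  have h2 : (1 : ENNReal) = (volume : Measure unitInterval) univ := by simp
  rw [h2, ← union_compl_self (j ⁻¹' (B ∩ {x | ∀ n, x n ∈ A n}))] at h1
  have h3 := measure_union_le (μ := (volume : Measure unitInterval))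
    (j ⁻¹' (B ∩ {x | ∀ n, x n ∈ A n})) (j ⁻¹' (B ∩ {x | ∀ n, x n ∈ A n}))ᶜ
  rw [h0, zero_add] at h3
  exact absurd h1 (not_lt.mpr h3)

/-! ### Minimal Cantor sets -/

/-- The points of the sparse cube with a prescribed `0` digit and a prescribed `1` digit. -/
def sparsePiece (i j k : ℕ) : Set HilbertCube :=
  sparseCube '' {v | v i j = false ∧ v i k = true}

/-- The points of the Hilbert cube with all coordinates in `{0, 1}`. -/
def cornerSet : Set HilbertCube := {x | ∀ n, x n = 0 ∨ x n = 1}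

/-- The family of sets into which the sparse cube is decomposed. -/
def standardPieces : Set (Set HilbertCube) :=
  insert cornerSet (range fun p : {p : ℕ × ℕ × ℕ // p.2.1 ≠ p.2.2} =>
    sparsePiece p.1.1 p.1.2.1 p.1.2.2)

theorem countable_standardPieces : standardPieces.Countable :=
  (countable_range _).insert _

theorem range_sparseCube_subset : range sparseCube ⊆ ⋃₀ standardPieces := by
  rintro _ ⟨v, rfl⟩
  by_cases h : ∀ i j, v i j = v i 0
  · refine ⟨cornerSet, mem_insert _ _, fun n => ?_⟩
    have hv : v n = fun _ => v n 0 := funext (h n)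
    simp only [sparseCube]
    rw [hv]
    cases v n 0
    · exact Or.inl sparsePoint_const_false
    · exact Or.inr sparsePoint_const_true
  · push Not at h
    obtain ⟨i, j, hij⟩ := h
    cases h1 : v i j
    · refine ⟨_, mem_insert_of_mem _ ⟨⟨(i, j, 0), fun h => hij (by simp only at h; rw [h])⟩, rfl⟩,
        v, ⟨h1, ?_⟩, rfl⟩
      rw [h1] at hij
      simpa using hij.symm
    · refine ⟨_, mem_insert_of_mem _ ⟨⟨(i, 0, j), fun h => hij (by simp only at h; rw [h])⟩, rfl⟩,
        v, ⟨?_, h1⟩, rfl⟩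
      rw [h1] at hij
      simpa using hij.symm

theorem isStandard_of_range_subset_piece {f : (ℕ → Bool) → HilbertCube} (hf : Continuous f)
    (hinj : Function.Injective f) {P : Set HilbertCube} (hP : P ∈ standardPieces)
    (h : range f ⊆ P) : IsStandard f := by
  rcases hP with rfl | ⟨⟨⟨i, j, k⟩, hjk⟩, rfl⟩
  · exact isStandard_of_corners hf hinj fun c => h (mem_range_self c)
  · have key : ∀ c, ∃ v : ℕ → ℕ → Bool, (v i j = false ∧ v i k = true) ∧ sparseCube v = f c :=
      fun c => h (mem_range_self c)
    choose α h1 h2 using key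
    exact isStandard_of_sparse hf hinj (fun c => (h2 c).symm) (N := max j k + 1)
      (fun c => ⟨j, by omega, (h1 c).1⟩) (fun c => ⟨k, by omega, (h1 c).2⟩)

/-- A sparse piece fixes two bits of the array and is a Cantor cube over the remaining positions. -/
theorem isCantorSet_of_mem_standardPieces {P : Set HilbertCube} (hP : P ∈ standardPieces) :
    IsCantorSet P := by
  rcases hP with rfl | ⟨⟨⟨i, j, k⟩, hjk⟩, rfl⟩
  · have : cornerSet =
        range fun (c : ℕ → Bool) (n : ℕ) => if c n then (1 : unitInterval) else 0 := by
      ext x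
      constructor
      · intro hx
        refine ⟨fun n => decide (x n = 1), funext fun n => ?_⟩
        rcases hx n with h | h <;> simp [h]
      · rintro ⟨c, rfl⟩ n
        cases h : c n <;> simp [h]
    rw [this]
    refine isCantorSet_range (continuous_pi fun n => ?_) fun c d h => funext fun n => ?_
    · exact (continuous_of_discreteTopology
        (f := fun b : Bool => if b then (1 : unitInterval) else 0)).comp (continuous_apply n)
    · have := congrFun h n
      revert this
      cases c n <;> cases d n <;> simp
  · simp only at hjk
    let S := {p : ℕ × ℕ // p ≠ (i, j) ∧ p ≠ (i, k)}
    have : Infinite S := by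
      refine Infinite.of_injective (fun n : ℕ => (⟨(i + 1, n), by simp, by simp⟩ : S)) ?_
      intro m n h
      exact (Prod.mk.inj (congrArg Subtype.val h)).2
    obtain ⟨e⟩ : Nonempty (S ≃ ℕ) := nonempty_equiv_of_countable
    let F : (ℕ → Bool) → ℕ → ℕ → Bool := fun w a b =>
      if h : (a, b) ≠ (i, j) ∧ (a, b) ≠ (i, k) then w (e ⟨(a, b), h⟩) else decide (b = k)
    have hF : range F = {v | v i j = false ∧ v i k = true} := by
      ext v
      constructor
      · rintro ⟨w, rfl⟩
        simp [F, hjk]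
      · rintro ⟨h1, h2⟩
        refine ⟨fun n => v (e.symm n).1.1 (e.symm n).1.2, funext₂ fun a b => ?_⟩
        by_cases h : (a, b) ≠ (i, j) ∧ (a, b) ≠ (i, k)
        · simp only [F, dif_pos h]
          simp
        · simp only [F, dif_neg h]
          by_cases h' : (a, b) = (i, j)
          · obtain ⟨rfl, rfl⟩ := Prod.mk.inj h'
            simp [h1, hjk]
          · have h'' : (a, b) = (i, k) := by tauto
            obtain ⟨rfl, rfl⟩ := Prod.mk.inj h''
            simp [h2]
    have hFc : Continuous F := by
      refine continuous_pi fun a => continuous_pi fun b => ?_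
      by_cases h : (a, b) ≠ (i, j) ∧ (a, b) ≠ (i, k)
      · simp only [F, dif_pos h]
        fun_prop
      · simp only [F, dif_neg h]
        exact continuous_const
    have hFi : Function.Injective F := by
      intro w w' h
      funext n
      have := congrFun (congrFun h (e.symm n).1.1) (e.symm n).1.2
      simp only [F, Prod.mk.eta] at this
      rw [dif_pos (e.symm n).2, dif_pos (e.symm n).2] at this
      simpa using this
    change IsCantorSet (sparsePiece i j k)
    rw [sparsePiece, ← hF, ← range_comp]
    exact isCantorSet_range (continuous_sparseCube.comp hFc) (sparseCube_injective.comp hFi)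

theorem exists_homeomorph_pi_into_sparse {A : ℕ → Set unitInterval} (hA : ∀ n, IsClosed (A n))
    (hn : ∀ n, IsNowhereDense (A n)) :
    ∃ G : HilbertCube ≃ₜ HilbertCube, ∀ x : HilbertCube, (∀ n, x n ∈ A n) →
      G x ∈ range sparseCube := by
  choose g hg using fun n => exists_homeomorph_into_range_sparsePoint (hA n) (hn n)
  refine ⟨Homeomorph.piCongrRight g, fun x hx => ?_⟩
  choose v hv using fun n => hg n (x n) (hx n)
  exact ⟨v, funext hv⟩

/-- An uncountable closed part of `B` moves into the sparse cube; one of the countably many pieces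
meets it in an uncountable closed set, to which the perfect set theorem applies. -/
theorem exists_isStandard_range_subset {B : Set HilbertCube} (hB : IsCantorSet B) :
    ∃ f : (ℕ → Bool) → HilbertCube, range f ⊆ B ∧ IsStandard f := by
  obtain ⟨A, hA, hAn, hc⟩ := exists_pi_inter_not_countable hB.isCompact.isClosed hB.not_countable
  obtain ⟨G, hG⟩ := exists_homeomorph_pi_into_sparse hA hAn
  have hcl : IsClosed (B ∩ {x | ∀ n, x n ∈ A n}) := by
    refine hB.isCompact.isClosed.inter ?_
    simp only [ofPred_forall]
    exact isClosed_iInter fun n => (hA n).preimage (continuous_apply n)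
  obtain ⟨P, hP, hPc⟩ : ∃ P ∈ standardPieces,
      ¬ ((B ∩ {x | ∀ n, x n ∈ A n}) ∩ G ⁻¹' P).Countable := by
    by_contra! h
    refine hc ((countable_standardPieces.biUnion h).mono fun x hx => ?_)
    obtain ⟨P, hP, hxP⟩ := range_sparseCube_subset (hG x hx.2)
    exact mem_biUnion hP ⟨hx, hxP⟩
  have hPcl : IsClosed P := (isCantorSet_of_mem_standardPieces hP).isCompact.isClosed
  obtain ⟨f, hf, hfc, hfi⟩ :=
    (hcl.inter (hPcl.preimage G.continuous)).exists_nat_bool_injection_of_not_countable hPc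
  refine ⟨f, fun x hx => (hf hx).1.1, IsStandard.of_comp G ?_⟩
  exact isStandard_of_range_subset_piece (G.continuous.comp hfc) (G.injective.comp hfi) hP
    (by rintro _ ⟨c, rfl⟩; exact (hf (mem_range_self c)).2)

/-- Two standard embeddings differ by a homeomorphism of the cube, and `B` contains the range of
one. -/
theorem isMinimalCantorSet_preimage_piece (G : HilbertCube ≃ₜ HilbertCube) {P : Set HilbertCube}
    (hP : P ∈ standardPieces) : IsMinimalCantorSet (G ⁻¹' P) := by
  obtain ⟨f, hf, hi, rfl⟩ := (isCantorSet_of_mem_standardPieces hP).exists_param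
  have hr : G ⁻¹' range f = range fun c => G.symm (f c) := by
    ext x
    constructor
    · rintro ⟨c, hc⟩
      exact ⟨c, by simp [hc]⟩
    · rintro ⟨c, rfl⟩
      exact ⟨c, by simp⟩
  have hs : IsStandard fun c => G.symm (f c) :=
    IsStandard.of_comp G (by
      simpa using isStandard_of_range_subset_piece hf hi hP subset_rfl)
  rw [hr]
  refine ⟨isCantorSet_range (G.symm.continuous.comp hf) (G.symm.injective.comp hi),
    fun B hB => ?_⟩
  obtain ⟨h₁, hh₁⟩ := hs
  obtain ⟨f', hf', h₂, hh₂⟩ := exists_isStandard_range_subset hB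
  refine ⟨h₁.trans h₂.symm, ?_⟩
  rintro _ ⟨_, ⟨c, rfl⟩, rfl⟩
  refine hf' ⟨c, ?_⟩
  rw [Homeomorph.trans_apply, hh₁, ← hh₂, Homeomorph.symm_apply_apply]

/-! ### The ideal generated by the minimal Cantor sets -/

theorem sigmaIdeal_mono {X : Type*} {F : Set (Set X)} {A B : Set X} (h : A ⊆ B)
    (hB : B ∈ sigmaIdeal F) : A ∈ sigmaIdeal F := by
  obtain ⟨𝒜, h1, h2, h3⟩ := hB
  exact ⟨𝒜, h1, h2, h.trans h3⟩

theorem sigmaIdeal_iUnion {X ι : Type*} [Countable ι] {F : Set (Set X)} {A : ι → Set X}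
    (h : ∀ i, A i ∈ sigmaIdeal F) : ⋃ i, A i ∈ sigmaIdeal F := by
  choose 𝒜 h1 h2 h3 using h
  refine ⟨⋃ i, 𝒜 i, iUnion_subset h1, countable_iUnion h2, iUnion_subset fun i => ?_⟩
  exact (h3 i).trans (sUnion_subset_sUnion (subset_iUnion 𝒜 i))

theorem pi_mem_sigmaC₀ {A : ℕ → Set unitInterval} (hA : ∀ n, IsClosed (A n))
    (hn : ∀ n, IsNowhereDense (A n)) : {x : HilbertCube | ∀ n, x n ∈ A n} ∈ sigmaC₀ := by
  obtain ⟨G, hG⟩ := exists_homeomorph_pi_into_sparse hA hn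
  refine ⟨(fun P => G ⁻¹' P) '' standardPieces, ?_, countable_standardPieces.image _, ?_⟩
  · rintro _ ⟨P, hP, rfl⟩
    exact isMinimalCantorSet_preimage_piece G hP
  · intro x hx
    obtain ⟨P, hP, hxP⟩ := range_sparseCube_subset (hG x hx)
    exact ⟨_, ⟨P, hP, rfl⟩, hxP⟩

theorem exists_isCantorSet_superset {A : Set unitInterval} (hA : IsClosed A)
    (hn : IsNowhereDense A) : ∃ C : Set unitInterval, IsCantorSet C ∧ A ⊆ C := by
  obtain ⟨g, hg⟩ := exists_homeomorph_into_range_sparsePoint hA hn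
  refine ⟨range fun e => g.symm (sparsePoint e),
    isCantorSet_range (g.symm.continuous.comp continuous_sparsePoint)
      (g.symm.injective.comp sparsePoint_injective), fun a ha => ?_⟩
  obtain ⟨e, he⟩ := hg a ha
  exact ⟨e, by simp [he]⟩

theorem IsCantorSet.subsingleton_of_isPreconnected {X : Type*} [TopologicalSpace X] {C S : Set X}
    (hC : IsCantorSet C) (hSC : S ⊆ C) (hS : IsPreconnected S) : S.Subsingleton := by
  obtain ⟨e⟩ := hC
  have h1 : IsPreconnected (Subtype.val ⁻¹' S : Set C) := by
    rw [← IsInducing.subtypeVal.isPreconnected_image, Subtype.image_preimage_coe,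
      inter_eq_right.mpr hSC]
    exact hS
  have h2 := (h1.image e e.continuous.continuousOn).subsingleton
  intro x hx y hy
  have := h2 ⟨⟨x, hSC hx⟩, hx, rfl⟩ ⟨⟨y, hSC hy⟩, hy, rfl⟩
  simpa using this

/-- A ball of the interval mapped into a Cantor set is connected, hence a single point, but the
interval has no isolated points. -/
theorem IsCantorSet.preimage_interior_eq_empty {X : Type*} [TopologicalSpace X] {C : Set X}
    (hC : IsCantorSet C) {φ : unitInterval → X} (hφ : Continuous φ) (hi : Function.Injective φ) :
    φ ⁻¹' interior C = ∅ := by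
  by_contra hne
  obtain ⟨x, hx⟩ := nonempty_iff_ne_empty.mpr hne
  obtain ⟨ε, hε, hball⟩ := Metric.isOpen_iff.mp (isOpen_interior.preimage hφ) x hx
  have hconn : (Metric.ball x ε).OrdConnected := by
    refine ⟨fun a ha b hb c hc => ?_⟩
    rw [Metric.mem_ball, Subtype.dist_eq, Real.dist_eq, abs_lt] at *
    have h1 : (a : ℝ) ≤ c := hc.1
    have h2 : (c : ℝ) ≤ b := hc.2
    constructor <;> linarith [ha.1, hb.2]
  have hsub := hC.subsingleton_of_isPreconnected
    ((image_mono hball).trans ((image_preimage_subset _ _).trans interior_subset))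
    (hconn.isPreconnected.image φ hφ.continuousOn)
  have hopen : IsOpen ({x} : Set unitInterval) := by
    have : Metric.ball x ε = {x} :=
      (hi.subsingleton_image_iff.mp hsub).eq_singleton_of_mem (Metric.mem_ball_self hε)
    rw [← this]
    exact Metric.isOpen_ball
  exact not_isOpen_singleton x hopen

theorem IsCantorSet.isNowhereDense_unitInterval {C : Set unitInterval} (hC : IsCantorSet C) :
    IsNowhereDense C := by
  rw [IsNowhereDense, hC.isCompact.isClosed.closure_eq]
  exact hC.preimage_interior_eq_empty continuous_id Function.injective_id

theorem IsCantorSet.isNowhereDense_hilbertCube {C : Set HilbertCube} (hC : IsCantorSet C) :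
    IsNowhereDense C := by
  rw [IsNowhereDense, hC.isCompact.isClosed.closure_eq, eq_empty_iff_forall_notMem]
  intro x hx
  have h := hC.preimage_interior_eq_empty (φ := fun t => Function.update x 0 t) (by fun_prop)
    (Function.update_injective x 0)
  exact eq_empty_iff_forall_notMem.mp h (x 0) (by simpa using hx)

theorem sigmaC₀_subset_meagerIdeal : sigmaC₀ ⊆ meagerIdeal HilbertCube := by
  rintro A ⟨𝒜, h1, h2, h3⟩
  refine IsMeagre.mono h3 ?_
  rw [sUnion_eq_biUnion]
  exact isMeagre_biUnion h2 fun C hC => (h1 hC).1.isNowhereDense_hilbertCube.isMeagre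

/-! ### Transfer of meagre sets along irreducible maps -/

section Irreducible

variable {X Y : Type*} [TopologicalSpace X] [TopologicalSpace Y] [CompactSpace X] [T2Space Y]

/-- Points of `D` over the image lie in `K` themselves, so the preimage of the interior of the image
is an open subset of `K`. -/
theorem isNowhereDense_image_of_dense_fibres {β : X → Y} (hβ : Continuous β)
    (hs : Function.Surjective β) {D : Set X} (hD : Dense D)
    (hfib : ∀ w ∈ D, ∀ v, β v = β w → v = w) {K : Set X} (hK : IsClosed K)
    (hn : IsNowhereDense K) : IsNowhereDense (β '' K) := by
  rw [IsNowhereDense, (hK.isCompact.image hβ).isClosed.closure_eq]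
  rw [IsNowhereDense, hK.closure_eq] at hn
  have hV : IsOpen (β ⁻¹' interior (β '' K)) := isOpen_interior.preimage hβ
  have hsub : β ⁻¹' interior (β '' K) ⊆ K := by
    refine (hD.open_subset_closure_inter hV).trans (closure_minimal ?_ hK)
    rintro w ⟨hw, hwD⟩
    obtain ⟨v, hv, hvw⟩ := interior_subset hw
    exact hfib w hwD v hvw ▸ hv
  have h0 := interior_maximal hsub hV
  rw [hn, subset_empty_iff] at h0
  rw [← image_preimage_eq (interior (β '' K)) hs, h0, image_empty]

/-- For `V` open inside the preimage, the points whose whole fibre lies in `V` form an open subset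
of `K`; singleton fibres make it nonempty. -/
theorem isNowhereDense_preimage_of_dense_fibres {β : X → Y} (hβ : Continuous β)
    (hs : Function.Surjective β) {D : Set X} (hD : Dense D)
    (hfib : ∀ w ∈ D, ∀ v, β v = β w → v = w) {K : Set Y} (hK : IsClosed K)
    (hn : IsNowhereDense K) : IsNowhereDense (β ⁻¹' K) := by
  rw [IsNowhereDense, (hK.preimage hβ).closure_eq]
  rw [IsNowhereDense, hK.closure_eq] at hn
  by_contra hne
  obtain ⟨w, hw, hwD⟩ :=
    hD.inter_open_nonempty _ isOpen_interior (nonempty_iff_ne_empty.mpr hne)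
  set V := interior (β ⁻¹' K)
  have hU : IsOpen (β '' Vᶜ)ᶜ :=
    (isOpen_interior.isClosed_compl.isCompact.image hβ).isClosed.isOpen_compl
  have hUK : (β '' Vᶜ)ᶜ ⊆ K := by
    intro y hy
    obtain ⟨v, rfl⟩ := hs y
    by_contra h
    exact hy ⟨v, fun hv => h (show v ∈ β ⁻¹' K from interior_subset hv), rfl⟩
  have hmem : β w ∈ (β '' Vᶜ)ᶜ := by
    rintro ⟨v, hv, hvw⟩
    exact hv (hfib w hwD v hvw ▸ hw)
  have := interior_maximal hUK hU hmem
  rw [hn] at this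
  exact this

end Irreducible

theorem IsMeagre.exists_closed_cover {X : Type*} [TopologicalSpace X] {M : Set X}
    (hM : IsMeagre M) :
    ∃ K : ℕ → Set X, (∀ n, IsClosed (K n)) ∧ (∀ n, IsNowhereDense (K n)) ∧ M ⊆ ⋃ n, K n := by
  obtain ⟨S, hS, hc, hsub⟩ := isMeagre_iff_countable_union_isNowhereDense.mp hM
  obtain ⟨f, hf⟩ := (hc.insert ∅).exists_eq_range (insert_nonempty _ _)
  refine ⟨fun n => closure (f n), fun n => isClosed_closure, fun n => ?_, fun x hx => ?_⟩
  · have : f n ∈ insert ∅ S := hf ▸ mem_range_self n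
    rcases this with h | h
    · simp only [h]
      simp [IsNowhereDense]
    · exact (hS _ h).closure
  · obtain ⟨t, ht, hxt⟩ := hsub hx
    have : t ∈ range f := hf ▸ mem_insert_of_mem _ ht
    obtain ⟨n, rfl⟩ := this
    exact mem_iUnion.mpr ⟨n, subset_closure hxt⟩

/-- The point of the Hilbert cube whose coordinates have the binary expansions given by the rows of
an array of bits. -/
noncomputable def binaryCube (w : ℕ → ℕ → Bool) : HilbertCube := fun n => binaryPoint (w n)

theorem continuous_binaryCube : Continuous binaryCube :=
  continuous_pi fun n => continuous_binaryPoint.comp (continuous_apply n)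

theorem binaryCube_surjective : Function.Surjective binaryCube := fun x => by
  choose w hw using fun n => binaryPoint_surjective (x n)
  exact ⟨w, funext hw⟩

theorem dense_pi_nondyadic : Dense {w : ℕ → ℕ → Bool | ∀ n, w n ∈ nondyadic} := by
  have := dense_pi (univ : Set ℕ) (s := fun _ => nondyadic) fun _ _ => dense_nondyadic
  simpa [Set.pi] using this

theorem eq_of_binaryCube_eq : ∀ w ∈ {w : ℕ → ℕ → Bool | ∀ n, w n ∈ nondyadic}, ∀ v,
    binaryCube v = binaryCube w → v = w :=
  fun _ hw _ h => funext fun n => eq_of_binaryPoint_eq (hw n) (congrFun h n)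

theorem isNowhereDense_image_binaryPoint {K : Set (ℕ → Bool)} (hK : IsClosed K)
    (hn : IsNowhereDense K) : IsNowhereDense (binaryPoint '' K) :=
  isNowhereDense_image_of_dense_fibres continuous_binaryPoint binaryPoint_surjective
    dense_nondyadic (fun _ hw _ h => eq_of_binaryPoint_eq hw h) hK hn

theorem isMeagre_image_binaryCube {M : Set (ℕ → ℕ → Bool)} (hM : IsMeagre M) :
    IsMeagre (binaryCube '' M) := by
  obtain ⟨K, hK, hn, hsub⟩ := hM.exists_closed_cover
  refine IsMeagre.mono ((image_mono hsub).trans_eq (image_iUnion)) (isMeagre_iUnion fun n => ?_)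
  exact (isNowhereDense_image_of_dense_fibres continuous_binaryCube binaryCube_surjective
    dense_pi_nondyadic eq_of_binaryCube_eq (hK n) (hn n)).isMeagre

/-! ### Patterns that avoid a meagre set -/

/-- The arrays `w` and `t` agree on `[0, e) × [0, e)` outside `[0, m) × [0, m)`. -/
def SquareAgree (m e : ℕ) (w t : ℕ → ℕ → Bool) : Prop :=
  ∀ i j, i < e → j < e → (m ≤ i ∨ m ≤ j) → w i j = t i j

theorem SquareAgree.mono {m e e' : ℕ} {w t : ℕ → ℕ → Bool} (h : SquareAgree m e' w t)
    (he : e ≤ e') : SquareAgree m e w t :=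
  fun i j hi hj hm => h i j (by omega) (by omega) hm

theorem exists_square_subset {U : Set (ℕ → ℕ → Bool)} (hU : IsOpen U) {w : ℕ → ℕ → Bool}
    (hw : w ∈ U) : ∃ L, ∀ v, SquareAgree 0 L v w → v ∈ U := by
  by_contra! h
  choose v hv hvU using h
  have hlim : Tendsto v atTop (𝓝 w) := by
    rw [tendsto_pi_nhds]
    intro i
    rw [tendsto_pi_nhds]
    intro j
    refine tendsto_const_nhds.congr' ?_
    filter_upwards [eventually_gt_atTop (max i j)] with L hL
    exact (hv L i j (by omega) (by omega) (by omega)).symm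
  obtain ⟨L, hL⟩ := (hlim.eventually (hU.mem_nhds hw)).exists
  exact hvU L hL

theorem isClopen_setOf_squareAgree (m e : ℕ) (t : ℕ → ℕ → Bool) :
    IsClopen {w | SquareAgree m e w t} := by
  have : {w | SquareAgree m e w t} = ⋂ i ∈ Iio e, ⋂ j ∈ Iio e,
      {w : ℕ → ℕ → Bool | (m ≤ i ∨ m ≤ j) → w i j = t i j} := by
    ext w
    simp only [SquareAgree, mem_ofPred_eq, mem_iInter, mem_Iio]
    exact ⟨fun h i hi j hj hm => h i j hi hj hm, fun h i j hi hj hm => h i hi j hj hm⟩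
  rw [this]
  refine (finite_Iio e).isClopen_biInter fun i _ => (finite_Iio e).isClopen_biInter fun j _ => ?_
  by_cases hm : m ≤ i ∨ m ≤ j
  · simp only [hm, true_imp_iff]
    exact (isClopen_discrete {t i j}).preimage (f := fun w : ℕ → ℕ → Bool => w i j) (by fun_prop)
  · simp only [hm, false_imp_iff]
    exact isClopen_univ

/-- There are finitely many fillings of the `m × m` square; the pattern is extended once for each,
escaping `K` for that filling. -/
theorem exists_pattern {K : Set (ℕ → ℕ → Bool)} (hK : IsClosed K) (hn : IsNowhereDense K)
    (m : ℕ) : ∃ e > m, ∃ t, ∀ w, SquareAgree m e w t → w ∉ K := by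
  have hd : Dense Kᶜ := (isClosed_isNowhereDense_iff_compl.mp ⟨hK, hn⟩).2
  have key : ∀ s : Finset (Fin m → Fin m → Bool), ∃ e > m, ∃ t, ∀ p ∈ s, ∀ w,
      (∀ i j : Fin m, w i j = p i j) → SquareAgree m e w t → w ∉ K := by
    classical
    intro s
    induction s using Finset.induction_on with
    | empty => exact ⟨m + 1, by omega, fun _ _ => false, by simp⟩
    | insert p s _ ih =>
      obtain ⟨e, he, t, ht⟩ := ih
      let w₀ : ℕ → ℕ → Bool := fun i j =>
        if h : i < m ∧ j < m then p ⟨i, h.1⟩ ⟨j, h.2⟩ else t i j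
      obtain ⟨w₁, hw₁, hw₁K⟩ := hd.inter_open_nonempty _ (isClopen_setOf_squareAgree 0 e w₀).isOpen
        ⟨w₀, fun _ _ _ _ _ => rfl⟩
      obtain ⟨L, hL⟩ := exists_square_subset hK.isOpen_compl hw₁K
      refine ⟨max e L, by omega, w₁, fun q hq w hwq hw => ?_⟩
      rcases Finset.mem_insert.mp hq with rfl | hq
      · refine hL w fun i j hi hj _ => ?_
        by_cases hij : i < m ∧ j < m
        · rw [hw₁ i j (by omega) (by omega) (by omega)]
          simp only [w₀, dif_pos hij]
          exact hwq ⟨i, hij.1⟩ ⟨j, hij.2⟩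
        · exact hw i j (by omega) (by omega) (by omega)
      · refine ht q hq w hwq fun i j hi hj hm => ?_
        rw [hw i j (by omega) (by omega) hm, hw₁ i j hi hj (by omega)]
        simp only [w₀, dif_neg (show ¬(i < m ∧ j < m) by omega)]
  obtain ⟨e, he, t, ht⟩ := key Finset.univ
  exact ⟨e, he, t, fun w => ht (fun i j => w i j) (Finset.mem_univ _) w fun _ _ => rfl⟩

/-- Combinatorial data witnessing that a subset of the Hilbert cube is meagre: a monotone sequence
of sets covering the set of binary expansions and, for each `m`, a pattern `t m` on
`[0, e m) × [0, e m)` outside `[0, m) × [0, m)` that avoids the `m`-th set. -/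
structure MeagreCode (M : Set HilbertCube) where
  K : ℕ → Set (ℕ → ℕ → Bool)
  e : ℕ → ℕ
  t : ℕ → ℕ → ℕ → Bool
  mono_K : Monotone K
  mono_e : Monotone e
  lt_e : ∀ m, m < e m
  avoid : ∀ m w, SquareAgree m (e m) w (t m) → w ∉ K m
  cover : ∀ w, binaryCube w ∈ M → ∃ k, w ∈ K k

theorem IsMeagre.nonempty_meagreCode {M : Set HilbertCube} (hM : IsMeagre M) :
    Nonempty (MeagreCode M) := by
  obtain ⟨F, hF, hFn, hsub⟩ := hM.exists_closed_cover
  let K : ℕ → Set (ℕ → ℕ → Bool) := fun n => ⋃ k ∈ Iic n, binaryCube ⁻¹' F k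
  have hKc : ∀ n, IsClosed (K n) := fun n =>
    (finite_Iic n).isClosed_biUnion fun k _ => (hF k).preimage continuous_binaryCube
  have hKn : ∀ n, IsNowhereDense (K n) := by
    intro n
    rw [IsNowhereDense, (hKc n).closure_eq, interior_eq_empty_iff_dense_compl]
    simp only [K, compl_iUnion]
    refine dense_biInter_of_isOpen
      (fun k _ => ((hF k).preimage continuous_binaryCube).isOpen_compl) (finite_Iic n).countable
      fun k _ => ?_
    rw [← interior_eq_empty_iff_dense_compl]
    have := isNowhereDense_preimage_of_dense_fibres continuous_binaryCube binaryCube_surjective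
      dense_pi_nondyadic eq_of_binaryCube_eq (hF k) (hFn k)
    rwa [IsNowhereDense, ((hF k).preimage continuous_binaryCube).closure_eq] at this
  choose e he t ht using fun m => exists_pattern (hKc m) (hKn m) m
  have hle : ∀ m, e m ≤ ∑ i ∈ Finset.range (m + 1), e i := fun m =>
    Finset.single_le_sum (f := e) (fun _ _ => Nat.zero_le _) (Finset.self_mem_range_succ m)
  -- Partial sums make the bound monotone; a longer agreement still avoids `K m`.
  refine ⟨⟨K, fun m => ∑ i ∈ Finset.range (m + 1), e i, t, ?_, ?_, ?_, ?_, ?_⟩⟩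
  · exact fun m n hmn => biUnion_subset_biUnion_left (Iic_subset_Iic.mpr hmn)
  · exact fun m n hmn => Finset.sum_le_sum_of_subset (Finset.range_mono (by omega))
  · exact fun m => (he m).trans_le (hle m)
  · exact fun m w hw => ht m w (hw.mono (hle m))
  · intro w hw
    obtain ⟨k, hk⟩ := mem_iUnion.mp (hsub hw)
    exact ⟨k, mem_biUnion (mem_Iic.mpr le_rfl) hk⟩

/-- An enumeration of the finite sets of pairs of natural numbers. -/
noncomputable def decodeFinset : ℕ → Finset (ℕ × ℕ) :=
  (exists_surjective_nat (Finset (ℕ × ℕ))).choose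

/-- A right inverse of `decodeFinset`. -/
noncomputable def encodeFinset : Finset (ℕ × ℕ) → ℕ :=
  Function.surjInv (exists_surjective_nat (Finset (ℕ × ℕ))).choose_spec

theorem decodeFinset_encodeFinset (s : Finset (ℕ × ℕ)) : decodeFinset (encodeFinset s) = s :=
  Function.surjInv_eq _ s

/-- The array assembled from coded patterns on the square annuli given by `r`. -/
noncomputable def assemble (r g : ℕ → ℕ) (i j : ℕ) : Bool := by
  classical
  exact decide (∃ n, r n ≤ max i j ∧ max i j < r (n + 1) ∧
    (i, j) ∈ decodeFinset (g n))

namespace MeagreCode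

variable {M : Set HilbertCube} (c : MeagreCode M)

/-- The codes of the patterns of `c` that sit at the starting points of the annuli given
by `r`. -/
noncomputable def pattern (r : ℕ → ℕ) (n : ℕ) : ℕ :=
  encodeFinset ((Finset.range (r (n + 1)) ×ˢ Finset.range (r (n + 1))).filter
    fun p => c.t (r n) p.1 p.2 = true)

theorem squareAgree_assemble {r g : ℕ → ℕ} (hr : StrictMono r) {n : ℕ}
    (h : g n = c.pattern r n) :
    SquareAgree (r n) (r (n + 1)) (assemble r g) (c.t (r n)) := by
  intro i j hi hj hm
  have hn : ∀ k, r k ≤ max i j → max i j < r (k + 1) → k = n := by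
    intro k h1 h2
    have h3 : k < n + 1 := hr.lt_iff_lt.mp (by omega)
    have h4 : n < k + 1 := hr.lt_iff_lt.mp (by omega)
    omega
  have hof : decodeFinset (g n) =
      (Finset.range (r (n + 1)) ×ˢ Finset.range (r (n + 1))).filter
        fun p => c.t (r n) p.1 p.2 = true := by
    rw [h, pattern, decodeFinset_encodeFinset]
  classical
  rw [Bool.eq_iff_iff, assemble, decide_eq_true_iff]
  constructor
  · rintro ⟨k, h1, h2, h3⟩
    rw [hn k h1 h2, hof] at h3
    exact (Finset.mem_filter.mp h3).2
  · intro ht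
    refine ⟨n, by omega, by omega, ?_⟩
    rw [hof, Finset.mem_filter, Finset.mem_product, Finset.mem_range, Finset.mem_range]
    exact ⟨⟨hi, hj⟩, ht⟩

theorem notMem_of_frequently {r : ℕ → ℕ} (hr : StrictMono r) {w : ℕ → ℕ → Bool}
    (h : ∃ᶠ n in atTop, c.e (r n) ≤ r (n + 1) ∧ SquareAgree (r n) (r (n + 1)) w (c.t (r n))) :
    binaryCube w ∉ M := by
  intro hw
  obtain ⟨k, hk⟩ := c.cover w hw
  obtain ⟨n, ⟨h1, h2⟩, hn⟩ := (h.and_eventually (eventually_ge_atTop k)).exists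
  exact c.avoid (r n) w (h2.mono h1) (c.mono_K (hn.trans hr.le_apply) hk)

end MeagreCode

/-! ### Catching a meagre set by infinitely often equal functions -/

/-- A strictly increasing function above `ρ`. -/
def growth (ρ : ℕ → ℕ) (n : ℕ) : ℕ := n + ∑ i ∈ Finset.range (n + 1), ρ i

theorem growth_strictMono (ρ : ℕ → ℕ) : StrictMono (growth ρ) :=
  strictMono_nat_of_lt_succ fun n => by
    rw [growth, growth, Finset.sum_range_succ _ (n + 1)]
    omega

theorem le_growth (ρ : ℕ → ℕ) (n : ℕ) : ρ n ≤ growth ρ n :=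
  (Finset.single_le_sum (f := ρ) (fun _ _ => Nat.zero_le _) (Finset.self_mem_range_succ n)).trans
    (Nat.le_add_left _ _)

/-- Otherwise `growth ρ` would eventually be bounded by iterates of `c.e`, hence by `c.e^[n] n`. -/
theorem MeagreCode.frequently_le_growth {M : Set HilbertCube} (c : MeagreCode M) {ρ : ℕ → ℕ}
    (h : ∃ᶠ n in atTop, c.e^[n] n < ρ n) :
    ∃ᶠ n in atTop, c.e (growth ρ n) ≤ growth ρ (n + 1) := by
  by_contra hcon
  rw [not_frequently] at hcon
  obtain ⟨n₀, hn₀⟩ := eventually_atTop.mp hcon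
  have hit : ∀ j, growth ρ (n₀ + j) ≤ c.e^[j] (growth ρ n₀) := by
    intro j
    induction j with
    | zero => exact le_rfl
    | succ j ih =>
      rw [Function.iterate_succ_apply']
      have := hn₀ (n₀ + j) (by omega)
      rw [← add_assoc]
      exact (not_le.mp this).le.trans (c.mono_e ih)
  obtain ⟨n, hn, hn'⟩ := (h.and_eventually
    (eventually_ge_atTop (max n₀ (growth ρ n₀)))).exists
  have h1 := hit (n - n₀)
  rw [Nat.add_sub_cancel' (by omega)] at h1
  have h2 : c.e^[n - n₀] (growth ρ n₀) ≤ c.e^[n - n₀] n := c.mono_e.iterate _ (by omega)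
  have h3 : c.e^[n - n₀] n ≤ c.e^[n] n :=
    Function.monotone_iterate_of_id_le (fun m => (c.lt_e m).le) (Nat.sub_le n n₀) n
  have := le_growth ρ n
  omega

section Matching

/-- The finite partial functions coded by the values of `g`. -/
noncomputable def partialCode (g : ℕ → ℕ) (n : ℕ) : Finset (ℕ × ℕ) := decodeFinset (g n)

/-- The set of arguments chosen before step `n`. -/
noncomputable def usedArgs (g : ℕ → ℕ) : ℕ → Finset ℕ
  | 0 => ∅
  | n + 1 => by
    classical
    exact if h : ((partialCode g n).image Prod.fst \ usedArgs g n).Nonempty then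
      insert (((partialCode g n).image Prod.fst \ usedArgs g n).min' h) (usedArgs g n)
    else usedArgs g n

/-- The function that takes, at each argument chosen at some step, the value of the partial function
considered at that step. -/
noncomputable def matchFun (g : ℕ → ℕ) (k : ℕ) : ℕ := by
  classical
  exact if h : ∃ v n, k ∈ usedArgs g (n + 1) ∧ k ∉ usedArgs g n ∧ (k, v) ∈ partialCode g n then
    h.choose else 0

theorem usedArgs_mono (g : ℕ → ℕ) : Monotone (usedArgs g) := by
  classical
  refine monotone_nat_of_le_succ fun n => ?_
  rw [usedArgs]
  split_ifs
  · exact Finset.subset_insert _ _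
  · exact le_rfl

theorem card_usedArgs_le (g : ℕ → ℕ) (n : ℕ) : (usedArgs g n).card ≤ n := by
  classical
  induction n with
  | zero => simp [usedArgs]
  | succ n ih =>
    rw [usedArgs]
    split_ifs
    · exact (Finset.card_insert_le _ _).trans (by omega)
    · omega

theorem exists_mem_usedArgs_succ {g : ℕ → ℕ} {n : ℕ}
    (h : n < ((partialCode g n).image Prod.fst).card) :
    ∃ k ∈ (partialCode g n).image Prod.fst, k ∈ usedArgs g (n + 1) ∧ k ∉ usedArgs g n := by
  classical
  have hne : ((partialCode g n).image Prod.fst \ usedArgs g n).Nonempty := by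
    rw [← Finset.card_pos]
    have := Finset.le_card_sdiff (usedArgs g n) ((partialCode g n).image Prod.fst)
    have := card_usedArgs_le g n
    omega
  have hmem := Finset.min'_mem _ hne
  rw [Finset.mem_sdiff] at hmem
  refine ⟨_, hmem.1, ?_, hmem.2⟩
  rw [usedArgs, dif_pos hne]
  exact Finset.mem_insert_self _ _

/-- The guess at step `n` should be the restriction of `f` to `n + 1` points of `X`. At most `n`
arguments were used before, so a correct guess settles a new one. The function `matchFun g` is built
without reference to `X`. -/
theorem exists_frequently_matchFun_eq {X : Set ℕ} (hX : X.Infinite) (f : ℕ → ℕ) :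
    ∃ f' : ℕ → ℕ, ∀ g : ℕ → ℕ, (∃ᶠ n in atTop, g n = f' n) →
      ∃ᶠ k in atTop, k ∈ X ∧ matchFun g k = f k := by
  classical
  choose S hSX hScard using fun n : ℕ => hX.exists_subset_card_eq (n + 1)
  refine ⟨fun n => encodeFinset ((S n).image fun k => (k, f k)), fun g hg => ?_⟩
  have hcode : ∀ n, g n = encodeFinset ((S n).image fun k => (k, f k)) →
      partialCode g n = (S n).image fun k => (k, f k) := fun n hn => by
    rw [partialCode, hn, decodeFinset_encodeFinset]
  have key : ∀ n, g n = encodeFinset ((S n).image fun k => (k, f k)) →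
      ∃ k ∈ X, k ∈ usedArgs g (n + 1) ∧ k ∉ usedArgs g n ∧ matchFun g k = f k := by
    intro n hn
    have himg : (partialCode g n).image Prod.fst = S n := by
      rw [hcode n hn, Finset.image_image]
      exact Finset.image_id
    obtain ⟨k, hk, h1, h2⟩ := exists_mem_usedArgs_succ (g := g) (n := n)
      (by rw [himg, hScard]; omega)
    rw [himg] at hk
    refine ⟨k, hSX n hk, h1, h2, ?_⟩
    have hex : ∃ v n, k ∈ usedArgs g (n + 1) ∧ k ∉ usedArgs g n ∧ (k, v) ∈ partialCode g n :=
      ⟨f k, n, h1, h2, by rw [hcode n hn]; exact Finset.mem_image_of_mem _ hk⟩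
    rw [matchFun, dif_pos hex]
    obtain ⟨n', h1', h2', h3⟩ := hex.choose_spec
    have hnn : n' = n := by
      by_contra hne
      rcases Nat.lt_or_gt_of_ne hne with hlt | hlt
      · exact h2 (usedArgs_mono g hlt h1')
      · exact h2' (usedArgs_mono g hlt h1)
    rw [hnn, hcode n hn] at h3
    obtain ⟨k', -, hk'⟩ := Finset.mem_image.mp h3
    obtain ⟨rfl, h4⟩ := Prod.mk.inj hk'
    exact h4.symm
  rw [frequently_atTop]
  intro N
  -- An argument is chosen at most once, so late steps choose only arguments at least `N`.
  have hunb : ∃ n₀, ∀ k < N, ∀ n ≥ n₀, k ∈ usedArgs g (n + 1) → k ∈ usedArgs g n := by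
    have : ∀ k, ∃ n₀, ∀ n ≥ n₀, k ∈ usedArgs g (n + 1) → k ∈ usedArgs g n := by
      intro k
      by_cases hk : ∃ n, k ∈ usedArgs g n
      · obtain ⟨n, hn⟩ := hk
        exact ⟨n, fun m hm _ => usedArgs_mono g hm hn⟩
      · exact ⟨0, fun n _ h => absurd ⟨_, h⟩ hk⟩
    choose n₀ hn₀ using this
    refine ⟨∑ k ∈ Finset.range N, n₀ k, fun k hk n hn => hn₀ k n (le_trans ?_ hn)⟩
    exact Finset.single_le_sum (f := n₀) (fun _ _ => Nat.zero_le _) (Finset.mem_range.mpr hk)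
  obtain ⟨n₀, hn₀⟩ := hunb
  obtain ⟨n, hn, hnn₀⟩ := (hg.and_eventually (eventually_ge_atTop n₀)).exists
  obtain ⟨k, hkX, h1, h2, h3⟩ := key n hn
  exact ⟨k, not_lt.mp fun hlt => h2 (hn₀ k hlt n hnn₀ h1), hkX, h3⟩

end Matching

/-- Two guesses of sufficiently many functions produce a point outside a given meagre set. -/
theorem IsMeagre.exists_guess {M : Set HilbertCube} (hM : IsMeagre M) :
    ∃ E : ℕ → ℕ, ∀ ρ : ℕ → ℕ, (∃ᶠ n in atTop, ρ n = E n) →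
      ∃ f : ℕ → ℕ, ∀ g : ℕ → ℕ, (∃ᶠ n in atTop, g n = f n) →
        binaryCube (assemble (growth ρ) (matchFun g)) ∉ M := by
  obtain ⟨c⟩ := hM.nonempty_meagreCode
  -- The `+ 1` turns equality into the strict inequality that `frequently_le_growth` needs.
  refine ⟨fun n => c.e^[n] n + 1, fun ρ hρ => ?_⟩
  have h1 := c.frequently_le_growth (ρ := ρ) (hρ.mono fun n hn => by
    simp only at hn
    omega)
  obtain ⟨f, hf⟩ := exists_frequently_matchFun_eq
    (Nat.frequently_atTop_iff_infinite.mp h1) (c.pattern (growth ρ))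
  refine ⟨f, fun g hg => c.notMem_of_frequently (growth_strictMono ρ) ((hf g hg).mono ?_)⟩
  rintro n ⟨hn, hng⟩
  exact ⟨hn, c.squareAgree_assemble (growth_strictMono ρ) hng⟩

/-! ### Covering a meagre set by means of dominating functions -/

/-- The sequence obtained by iterating `u`, made strictly increasing. -/
def iterSeq (u : ℕ → ℕ) : ℕ → ℕ
  | 0 => 0
  | n + 1 => max (iterSeq u n + 1) (u (iterSeq u n))

theorem iterSeq_strictMono (u : ℕ → ℕ) : StrictMono (iterSeq u) :=
  strictMono_nat_of_lt_succ fun n => by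
    rw [iterSeq]
    omega

/-- The set of arrays that differ from the assembled array on some annulus in each of the intervals
`[m, v m]` with sufficiently large `m`. -/
def arraysOff (u g v : ℕ → ℕ) : Set (ℕ → ℕ → Bool) :=
  {w | ∃ m₀, ∀ m ≥ m₀, ∃ n ∈ Icc m (v m),
    ¬ SquareAgree (iterSeq u n) (iterSeq u (n + 1)) w (assemble (iterSeq u) g)}

theorem isMeagre_arraysOff (u g v : ℕ → ℕ) : IsMeagre (arraysOff u g v) := by
  have heq : arraysOff u g v = ⋃ m₀, {w | ∀ m ≥ m₀, ∃ n ∈ Icc m (v m),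
      ¬ SquareAgree (iterSeq u n) (iterSeq u (n + 1)) w (assemble (iterSeq u) g)} := by
    ext w
    simp [arraysOff]
  rw [heq]
  refine isMeagre_iUnion fun m₀ => IsNowhereDense.isMeagre ?_
  have hcl : IsClosed {w | ∀ m ≥ m₀, ∃ n ∈ Icc m (v m),
      ¬ SquareAgree (iterSeq u n) (iterSeq u (n + 1)) w (assemble (iterSeq u) g)} := by
    have : {w | ∀ m ≥ m₀, ∃ n ∈ Icc m (v m),
        ¬ SquareAgree (iterSeq u n) (iterSeq u (n + 1)) w (assemble (iterSeq u) g)} =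
        ⋂ m, ⋂ (_ : m ≥ m₀), ⋃ n ∈ Icc m (v m),
          {w | SquareAgree (iterSeq u n) (iterSeq u (n + 1)) w (assemble (iterSeq u) g)}ᶜ := by
      ext w
      simp
    rw [this]
    exact isClosed_iInter fun m => isClosed_iInter fun _ => (finite_Icc _ _).isClosed_biUnion
      fun n _ => (isClopen_setOf_squareAgree _ _ _).isOpen.isClosed_compl
  rw [IsNowhereDense, hcl.closure_eq, eq_empty_iff_forall_notMem]
  intro w hw
  obtain ⟨L, hL⟩ := exists_square_subset isOpen_interior hw
  let w' : ℕ → ℕ → Bool := fun i j =>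
    if i < L ∧ j < L then w i j else assemble (iterSeq u) g i j
  have hw' : w' ∈ interior _ := hL w' fun i j hi hj _ => by simp [w', hi, hj]
  obtain ⟨n, hn, hne⟩ := interior_subset hw' (max m₀ L) (le_max_left _ _)
  refine hne fun i j _ _ hm => ?_
  have h1 : n ≤ iterSeq u n := (iterSeq_strictMono u).le_apply
  have h2 := hn.1
  simp only [w']
  rw [if_neg (by omega)]

/-- Bounding `c.e` makes almost all annuli long enough for their patterns, and `g` guesses
infinitely many patterns. Here `h m` is the position of a correct guess on a long annulus at or
after `m`. For large `m`, an expansion of a point of `M` differs from the assembled array there, and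
a bound on `h` confines that place to `[m, v m]`. -/
theorem IsMeagre.exists_cover {M : Set HilbertCube} (hM : IsMeagre M) :
    ∃ E : ℕ → ℕ, ∀ u : ℕ → ℕ, (∀ᶠ n in atTop, E n ≤ u n) →
      ∃ f : ℕ → ℕ, ∀ g : ℕ → ℕ, (∃ᶠ n in atTop, g n = f n) →
        ∃ h : ℕ → ℕ, ∀ v : ℕ → ℕ, (∀ᶠ n in atTop, h n ≤ v n) →
          M ⊆ binaryCube '' arraysOff u g v := by
  obtain ⟨c⟩ := hM.nonempty_meagreCode
  refine ⟨c.e, fun u hu => ⟨c.pattern (iterSeq u), fun g hg => ?_⟩⟩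
  have hr := iterSeq_strictMono u
  have hgood : ∀ᶠ n in atTop, c.e (iterSeq u n) ≤ iterSeq u (n + 1) :=
    (hr.tendsto_atTop.eventually hu).mono fun n hn => hn.trans (le_max_right _ _)
  have hfreq := frequently_atTop.mp (hg.and_eventually hgood)
  choose h hh1 hh2 hh3 using hfreq
  refine ⟨h, fun v hv x hx => ?_⟩
  obtain ⟨w, rfl⟩ := binaryCube_surjective x
  obtain ⟨k, hk⟩ := c.cover w hx
  obtain ⟨m₀, hm₀⟩ := eventually_atTop.mp hv
  refine ⟨w, ⟨max m₀ k, fun m hm => ⟨h m, ⟨hh1 m, hm₀ m (by omega)⟩, fun hagree => ?_⟩⟩, rfl⟩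
  have h1 := c.squareAgree_assemble hr (hh2 m)
  have h2 : SquareAgree (iterSeq u (h m)) (iterSeq u (h m + 1)) w (c.t (iterSeq u (h m))) :=
    fun i j hi hj hij => (hagree i j hi hj hij).trans (h1 i j hi hj hij)
  have h3 : h m ≤ iterSeq u (h m) := hr.le_apply
  have h4 := hh1 m
  exact c.avoid _ w (h2.mono (hh3 m)) (c.mono_K (by omega) hk)

/-! ### Nowhere dense sets of bit sequences -/

/-- The first true bit of `w` at or after `n` is at `n + L`. -/
def FirstOne (n L : ℕ) (w : ℕ → Bool) : Prop := (∀ j < L, w (n + j) = false) ∧ w (n + L) = true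

theorem isOpen_setOf_firstOne (n L : ℕ) : IsOpen {w | FirstOne n L w} := by
  have : {w | FirstOne n L w} =
      (⋂ j ∈ Iio L, {w : ℕ → Bool | w (n + j) = false}) ∩ {w | w (n + L) = true} := by
    ext w
    simp [FirstOne]
  rw [this]
  refine ((finite_Iio L).isOpen_biInter fun j _ => ?_).inter ?_
  · exact (isOpen_discrete {false}).preimage (f := fun w : ℕ → Bool => w (n + j)) (by fun_prop)
  · exact (isOpen_discrete {true}).preimage (f := fun w : ℕ → Bool => w (n + L)) (by fun_prop)

theorem isNowhereDense_of_extension {K : Set (ℕ → Bool)} (hK : IsClosed K)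
    (h : ∀ (w : ℕ → Bool) (N : ℕ), ∃ v ∉ K, ∀ k < N, v k = w k) : IsNowhereDense K := by
  rw [IsNowhereDense, hK.closure_eq, interior_eq_empty_iff_dense_compl, dense_iff_closure_eq,
    eq_univ_iff_forall]
  intro w
  choose v hv hvw using h w
  refine mem_closure_of_tendsto (b := atTop) (f := v) ?_ (Eventually.of_forall hv)
  rw [tendsto_pi_nhds]
  intro k
  refine tendsto_const_nhds.congr' ?_
  filter_upwards [eventually_gt_atTop k] with N hN
  exact (hvw N k hN).symm

/-- The sequences without the prescribed patterns at the positions in `S`. -/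
def avoidRow (S : Set ℕ) (L : ℕ → ℕ) : Set (ℕ → Bool) := {w | ∀ n ∈ S, ¬ FirstOne n (L n) w}

theorem isClosed_avoidRow (S : Set ℕ) (L : ℕ → ℕ) : IsClosed (avoidRow S L) := by
  have : avoidRow S L = ⋂ n ∈ S, {w | FirstOne n (L n) w}ᶜ := by
    ext w
    simp [avoidRow]
  rw [this]
  exact isClosed_biInter fun n _ => (isOpen_setOf_firstOne n (L n)).isClosed_compl

theorem isNowhereDense_avoidRow {S : Set ℕ} (hS : ∀ᶠ n in atTop, n ∈ S) (L : ℕ → ℕ) :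
    IsNowhereDense (avoidRow S L) := by
  refine isNowhereDense_of_extension (isClosed_avoidRow S L) fun w N => ?_
  obtain ⟨n, hn, hnN⟩ := (hS.and (eventually_ge_atTop N)).exists
  refine ⟨fun k => if k < n then w k else decide (k = n + L n), fun h => h n hn ⟨?_, ?_⟩, ?_⟩
  · intro j hj
    simp [hj.ne]
  · simp
  · intro k hk
    simp [show k < n by omega]

/-- The sequences with a true bit in each block `[F n, F (n + 1))` with `n ≥ m`. -/
def hitRow (F : ℕ → ℕ) (m : ℕ) : Set (ℕ → Bool) :=
  {w | ∀ n ≥ m, ∃ k ∈ Ico (F n) (F (n + 1)), w k = true}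

theorem isClosed_hitRow (F : ℕ → ℕ) (m : ℕ) : IsClosed (hitRow F m) := by
  have : hitRow F m = ⋂ n, ⋂ (_ : n ≥ m), ⋃ k ∈ Ico (F n) (F (n + 1)),
      {w : ℕ → Bool | w k = true} := by
    ext w
    simp [hitRow]
  rw [this]
  refine isClosed_iInter fun n => isClosed_iInter fun _ => (finite_Ico _ _).isClosed_biUnion
    fun k _ => ?_
  exact (isClosed_discrete {true}).preimage (f := fun w : ℕ → Bool => w k) (by fun_prop)

theorem isNowhereDense_hitRow {F : ℕ → ℕ} (hF : StrictMono F) (m : ℕ) :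
    IsNowhereDense (hitRow F m) := by
  refine isNowhereDense_of_extension (isClosed_hitRow F m) fun w N => ?_
  refine ⟨fun k => if k < N then w k else false, fun h => ?_, fun k hk => by simp [hk]⟩
  obtain ⟨k, hk, hkt⟩ := h (max m N) (le_max_left _ _)
  have h1 : max m N ≤ F (max m N) := hF.le_apply
  have h2 := hk.1
  simp only [show ¬ k < N by omega, if_false] at hkt
  exact absurd hkt (by simp)

/-! ### Sets in the ideal generated by the minimal Cantor sets -/

/-- The position of the first true bit at or after each place. -/
noncomputable def nextOne (w : ℕ → Bool) (n : ℕ) : ℕ := sInf {L | w (n + L) = true}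

theorem FirstOne.nextOne_eq {n L : ℕ} {w : ℕ → Bool} (h : FirstOne n L w) : nextOne w n = L := by
  refine le_antisymm (Nat.sInf_le h.2) (not_lt.mp fun hlt => ?_)
  have h1 : w (n + nextOne w n) = true := Nat.sInf_mem (s := {L | w (n + L) = true}) ⟨L, h.2⟩
  rw [h.1 _ hlt] at h1
  exact absurd h1 (by simp)

/-- The points that have binary expansions avoiding almost all patterns prescribed by `f`. -/
def avoidSet (f : ℕ → ℕ) : Set HilbertCube :=
  ⋃ m, {x | ∀ i, x i ∈ binaryPoint '' avoidRow {n | m ≤ Nat.pair i n} fun n => f (Nat.pair i n)}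

theorem avoidSet_mem_sigmaC₀ (f : ℕ → ℕ) : avoidSet f ∈ sigmaC₀ := by
  refine sigmaIdeal_iUnion fun m => pi_mem_sigmaC₀ (fun _ => ?_) fun i => ?_
  · exact ((isClosed_avoidRow _ _).isCompact.image continuous_binaryPoint).isClosed
  · refine isNowhereDense_image_binaryPoint (isClosed_avoidRow _ _)
      (isNowhereDense_avoidRow ?_ _)
    filter_upwards [eventually_ge_atTop m] with n hn
    exact hn.trans (Nat.right_le_pair i n)

/-- The function coding the binary expansions of the coordinates of a point. -/
noncomputable def pointCode (x : HilbertCube) (p : ℕ) : ℕ :=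
  nextOne (Function.surjInv binaryCube_surjective x (Nat.unpair p).1) (Nat.unpair p).2

/-- If the code eventually differed from `f`, the chosen expansion would avoid almost all the
prescribed patterns. -/
theorem frequently_pointCode_eq {x : HilbertCube} {f : ℕ → ℕ} (h : x ∉ avoidSet f) :
    ∃ᶠ p in atTop, pointCode x p = f p := by
  rw [frequently_atTop]
  intro m
  by_contra! hcon
  refine h (mem_iUnion.mpr ⟨m, fun i => ⟨Function.surjInv binaryCube_surjective x i,
    fun n hn hfirst => ?_, ?_⟩⟩)
  · refine hcon (Nat.pair i n) hn ?_
    simp only [pointCode, Nat.unpair_pair]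
    exact hfirst.nextOne_eq
  · exact congrFun (Function.surjInv_eq binaryCube_surjective x) i

/-- The points that have binary expansions meeting almost all blocks given by `f`. -/
def hitSet (f : ℕ → ℕ) : Set HilbertCube :=
  {x | ∀ i, x i ∈ binaryPoint '' hitRow (growth f) i}

theorem hitSet_mem_sigmaC₀ (f : ℕ → ℕ) : hitSet f ∈ sigmaC₀ :=
  pi_mem_sigmaC₀
    (fun _ => ((isClosed_hitRow _ _).isCompact.image continuous_binaryPoint).isClosed)
    fun i => isNowhereDense_image_binaryPoint (isClosed_hitRow _ _)
      (isNowhereDense_hitRow (growth_strictMono f) i)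

theorem IsMeagre.exists_bound_hitSet {M : Set HilbertCube} (hM : IsMeagre M) :
    ∃ u : ℕ → ℕ, ∀ f : ℕ → ℕ, hitSet f ⊆ M → ∀ᶠ n in atTop, f n ≤ u n := by
  obtain ⟨c⟩ := hM.nonempty_meagreCode
  set r := iterSeq c.e with hr
  have hrm : StrictMono r := iterSeq_strictMono _
  refine ⟨fun j => r (4 * j), fun f hf => ?_⟩
  set F := growth f with hF
  have hFm : StrictMono F := growth_strictMono f
  -- Annuli containing no whole block of `F`. Evenness keeps any two of them from being adjacent.
  let S : Set ℕ := {k | Even k ∧ ¬ ∃ n, r k ≤ F n ∧ F (n + 1) ≤ r (k + 1)}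
  by_cases hS : ∃ᶠ k in atTop, k ∈ S
  · exfalso
    classical
    -- Avoiding patterns on the annuli in `S`, true bits elsewhere. Infinitely many patterns keep
    -- the point out of `M`; a block of zeros would lie in a single annulus of `S`, so the point is
    -- in `hitSet f`.
    let w : ℕ → ℕ → Bool := fun i j =>
      if h : ∃ k ∈ S, r k ≤ max i j ∧ max i j < r (k + 1) then c.t (r h.choose) i j else true
    have huniq : ∀ {a k l : ℕ}, r k ≤ a → a < r (k + 1) → r l ≤ a → a < r (l + 1) → k = l := by
      intro a k l h1 h2 h3 h4
      have h5 : k < l + 1 := hrm.lt_iff_lt.mp (by omega)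
      have h6 : l < k + 1 := hrm.lt_iff_lt.mp (by omega)
      omega
    refine c.notMem_of_frequently hrm (w := w) (hS.mono fun k hk => ⟨le_max_right _ _, ?_⟩)
      (hf fun i => ⟨w i, fun n hn => ?_, rfl⟩)
    · intro i j hi hj hm
      have hex : ∃ k ∈ S, r k ≤ max i j ∧ max i j < r (k + 1) := ⟨k, hk, by omega, by omega⟩
      simp only [w]
      rw [dif_pos hex]
      have h1 := hex.choose_spec
      rw [huniq h1.2.1 h1.2.2 (show r k ≤ max i j by omega) (by omega)]
    · by_contra! hcon
      have hin : ∀ k ∈ Ico (F n) (F (n + 1)), ∃ κ ∈ S, r κ ≤ k ∧ k < r (κ + 1) := by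
        intro k hk
        have h1 := hcon k hk
        have h2 : n ≤ F n := hFm.le_apply
        have h3 := hk.1
        have h4 : max i k = k := by omega
        by_contra hno
        refine h1 ?_
        simp only [w, h4]
        rw [dif_neg hno]
      have hlt : F n < F (n + 1) := hFm (Nat.lt_succ_self n)
      obtain ⟨κ, hκ, h1, h2⟩ := hin (F n) ⟨le_rfl, hlt⟩
      rcases le_or_gt (F (n + 1)) (r (κ + 1)) with h3 | h3
      · exact hκ.2 ⟨n, h1, h3⟩
      · obtain ⟨l, hl, h4, h5⟩ := hin (r (κ + 1)) ⟨h2.le, h3⟩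
        have h6 : κ + 1 = l := huniq le_rfl (hrm (Nat.lt_succ_self _)) h4 h5
        have h7 := hκ.1
        have h8 := hl.1
        rw [← h6] at h8
        exact absurd h7 (Nat.even_add_one.mp h8)
  · rw [not_frequently] at hS
    obtain ⟨k₀, hk₀⟩ := eventually_atTop.mp hS
    -- Now every late even annulus contains a block, so the `j`-th of these blocks has index at
    -- least `j` and `r` bounds `F j`.
    have hblock : ∀ j, ∃ n, r (2 * (k₀ + j)) ≤ F n ∧ F (n + 1) ≤ r (2 * (k₀ + j) + 1) := by
      intro j
      have h1 := hk₀ (2 * (k₀ + j)) (by omega)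
      simp only [S, mem_ofPred_eq, not_and, not_not] at h1
      exact h1 (even_two_mul _)
    choose n hn1 hn2 using hblock
    have hnm : StrictMono n := strictMono_nat_of_lt_succ fun j => by
      have h1 : r (2 * (k₀ + j) + 1) ≤ r (2 * (k₀ + (j + 1))) := hrm.monotone (by omega)
      have h2 : F (n j + 1) ≤ F (n (j + 1)) := (hn2 j).trans (h1.trans (hn1 (j + 1)))
      have h3 := hFm.le_iff_le.mp h2
      omega
    filter_upwards [eventually_ge_atTop (k₀ + 1)] with j hj
    calc f j ≤ F j := le_growth f j
      _ ≤ F (n j + 1) := hFm.monotone ((hnm.le_apply).trans (Nat.le_succ _))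
      _ ≤ r (2 * (k₀ + j) + 1) := hn2 j
      _ ≤ r (4 * j) := hrm.monotone (by omega)

/-! ### Cardinal characteristics -/

open Cardinal hiding univ

theorem not_isMeagre_univ_hilbertCube : ¬ IsMeagre (univ : Set HilbertCube) :=
  not_isMeagre_of_isOpen isOpen_univ univ_nonempty

theorem mem_avoidSet_of_eventually_ne {x : HilbertCube} {f : ℕ → ℕ}
    (h : ∀ᶠ n in atTop, pointCode x n ≠ f n) : x ∈ avoidSet f := by
  by_contra hx
  exact frequently_pointCode_eq hx h

/-- Every function is eventually different from some member of `F`. -/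
def EventuallyDifferentFamily (F : Set (ℕ → ℕ)) : Prop :=
  ∀ g : ℕ → ℕ, ∃ f ∈ F, ∀ᶠ n in atTop, g n ≠ f n

theorem EventuallyDifferentFamily.sUnion_avoidSet {F : Set (ℕ → ℕ)}
    (hF : EventuallyDifferentFamily F) : ⋃₀ (avoidSet '' F) = univ := by
  rw [eq_univ_iff_forall]
  intro x
  obtain ⟨f, hf, hne⟩ := hF (pointCode x)
  exact ⟨_, ⟨f, hf, rfl⟩, mem_avoidSet_of_eventually_ne hne⟩

theorem avoidSet_image_subset (F : Set (ℕ → ℕ)) : avoidSet '' F ⊆ sigmaC₀ := by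
  rintro _ ⟨f, -, rfl⟩
  exact avoidSet_mem_sigmaC₀ f

theorem eventuallyDifferentFamily_univ : EventuallyDifferentFamily univ := fun g =>
  ⟨fun n => g n + 1, mem_univ _, Eventually.of_forall fun n => by simp⟩

theorem exists_cover_sigmaC₀ : ∃ 𝒜 : Set (Set HilbertCube), 𝒜 ⊆ sigmaC₀ ∧ ⋃₀ 𝒜 = univ :=
  ⟨_, avoidSet_image_subset univ, eventuallyDifferentFamily_univ.sUnion_avoidSet⟩

theorem countable_mem_sigmaC₀ {A : Set HilbertCube} (hA : A.Countable) : A ∈ sigmaC₀ := by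
  have : Countable A := hA
  refine sigmaIdeal_mono (fun x hx => mem_iUnion.mpr ⟨(⟨x, hx⟩ : A), ?_⟩)
    (sigmaIdeal_iUnion fun x : A => avoidSet_mem_sigmaC₀ fun n => pointCode x n + 1)
  exact mem_avoidSet_of_eventually_ne (Eventually.of_forall fun n => by simp)

theorem covIdeal_anti {X : Type} {I J : Set (Set X)} (h : I ⊆ J)
    (hne : ∃ 𝒜 ⊆ I, ⋃₀ 𝒜 = univ) : covIdeal J ≤ covIdeal I := by
  obtain ⟨𝒜, h1, h2⟩ := hne
  refine csInf_le_csInf' ⟨_, 𝒜, h1, h2, rfl⟩ ?_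
  rintro _ ⟨ℬ, h3, h4, rfl⟩
  exact ⟨ℬ, h3.trans h, h4, rfl⟩

theorem covIdeal_le {X : Type} {I 𝒜 : Set (Set X)} (h : 𝒜 ⊆ I) (hc : ⋃₀ 𝒜 = univ) :
    covIdeal I ≤ #𝒜 := csInf_le' ⟨𝒜, h, hc, rfl⟩

theorem exists_covIdeal_eq {X : Type} {I : Set (Set X)} (hne : ∃ 𝒜 ⊆ I, ⋃₀ 𝒜 = univ) :
    ∃ 𝒜 ⊆ I, ⋃₀ 𝒜 = univ ∧ #𝒜 = covIdeal I := by
  obtain ⟨𝒜, h1, h2⟩ := hne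
  exact csInf_mem (s := {κ | ∃ 𝒜 : Set (Set X), 𝒜 ⊆ I ∧ ⋃₀ 𝒜 = univ ∧ #𝒜 = κ})
    ⟨_, 𝒜, h1, h2, rfl⟩

theorem exists_cover_meagerIdeal :
    ∃ 𝒜 ⊆ meagerIdeal HilbertCube, ⋃₀ 𝒜 = univ := by
  obtain ⟨𝒜, h1, h2⟩ := exists_cover_sigmaC₀
  exact ⟨𝒜, h1.trans sigmaC₀_subset_meagerIdeal, h2⟩

/-- A cover by meagre sets yields an eventually different family that is not larger. -/
theorem exists_eventuallyDifferentFamily {𝒜 : Set (Set HilbertCube)}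
    (h : 𝒜 ⊆ meagerIdeal HilbertCube) (hc : ⋃₀ 𝒜 = univ) :
    ∃ F : Set (ℕ → ℕ), EventuallyDifferentFamily F ∧ #F ≤ #𝒜 := by
  by_contra! hcon
  -- With no eventually different family this small, one function guesses all members of a family
  -- indexed by `𝒜`; this is used for both guesses.
  have key : ∀ f : 𝒜 → ℕ → ℕ, ∃ g : ℕ → ℕ, ∀ A, ∃ᶠ n in atTop, g n = f A n := by
    intro f
    have h1 : ¬ EventuallyDifferentFamily (range f) := fun hF =>
      absurd (hcon _ hF) (not_lt.mpr mk_range_le)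
    simp only [EventuallyDifferentFamily] at h1
    push Not at h1
    obtain ⟨g, hg⟩ := h1
    exact ⟨g, fun A => hg _ (mem_range_self A)⟩
  choose E hE using fun A : 𝒜 => IsMeagre.exists_guess (h A.2)
  obtain ⟨ρ, hρ⟩ := key E
  choose f hf using fun A => hE A ρ (hρ A)
  obtain ⟨g, hg⟩ := key f
  have : binaryCube (assemble (growth ρ) (matchFun g)) ∈ ⋃₀ 𝒜 := hc ▸ mem_univ _
  obtain ⟨A, hA, hmem⟩ := this
  exact hf ⟨A, hA⟩ g (hg ⟨A, hA⟩) hmem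

theorem exists_eventuallyDifferentFamily_covIdeal :
    ∃ F : Set (ℕ → ℕ), EventuallyDifferentFamily F ∧
      #F ≤ covIdeal (meagerIdeal HilbertCube) := by
  obtain ⟨𝒜, h1, h2, h3⟩ := exists_covIdeal_eq exists_cover_meagerIdeal
  rw [← h3]
  exact exists_eventuallyDifferentFamily h1 h2

theorem covIdeal_sigmaC₀ : covIdeal sigmaC₀ = covIdeal (meagerIdeal HilbertCube) := by
  refine le_antisymm ?_ (covIdeal_anti sigmaC₀_subset_meagerIdeal exists_cover_sigmaC₀)
  obtain ⟨F, hF, hcard⟩ := exists_eventuallyDifferentFamily_covIdeal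
  exact (covIdeal_le (avoidSet_image_subset F) hF.sUnion_avoidSet).trans
    (mk_image_le.trans hcard)

/-- The codes of a set `A` outside the smaller ideal guess every function. Pairs of codes supply
both guesses, and `A × A` is no larger since `A` is infinite. -/
theorem nonIdeal_sigmaC₀ : nonIdeal sigmaC₀ = nonIdeal (meagerIdeal HilbertCube) := by
  have hsub := sigmaC₀_subset_meagerIdeal
  apply le_antisymm
  · refine csInf_le_csInf' ⟨_, univ, not_isMeagre_univ_hilbertCube, rfl⟩ ?_
    rintro _ ⟨A, hA, rfl⟩
    exact ⟨A, fun h => hA (hsub h), rfl⟩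
  · obtain ⟨A, hA, hcard⟩ : nonIdeal sigmaC₀ ∈
        {κ | ∃ A : Set HilbertCube, A ∉ sigmaC₀ ∧ #A = κ} :=
      csInf_mem ⟨_, univ, fun h => not_isMeagre_univ_hilbertCube (hsub h), rfl⟩
    have hinf : ℵ₀ ≤ #A := by
      by_contra hlt
      exact hA (countable_mem_sigmaC₀ (mk_le_aleph0_iff.mp (not_le.mp hlt).le))
    have hcode : ∀ f : ℕ → ℕ, ∃ x : A, ∃ᶠ n in atTop, pointCode x n = f n := by
      intro f
      by_contra! hcon
      refine hA (sigmaIdeal_mono (fun x hx => ?_) (avoidSet_mem_sigmaC₀ f))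
      exact mem_avoidSet_of_eventually_ne (hcon ⟨x, hx⟩)
    let P : A × A → HilbertCube := fun p =>
      binaryCube (assemble (growth (pointCode p.1)) (matchFun (pointCode p.2)))
    have hP : range P ∉ meagerIdeal HilbertCube := by
      intro hM
      obtain ⟨E, hE⟩ := IsMeagre.exists_guess hM
      obtain ⟨x, hx⟩ := hcode E
      obtain ⟨f, hf⟩ := hE _ hx
      obtain ⟨y, hy⟩ := hcode f
      exact hf _ hy ⟨(x, y), rfl⟩
    calc nonIdeal (meagerIdeal HilbertCube) ≤ #(range P) := csInf_le' ⟨_, hP, rfl⟩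
      _ ≤ #(A × A) := mk_range_le
      _ = #A := by simp only [mk_prod, lift_id, mul_eq_self hinf]
      _ = nonIdeal sigmaC₀ := hcard

/-- If unions of at most `#𝒜` sets from the smaller ideal are meagre, then functions indexed by `𝒜`
have common guesses, by `avoidSet`, and common bounds, by `hitSet`. Then `IsMeagre.exists_cover`
puts all of `𝒜` under one meagre set. -/
theorem addPair_sigmaC₀ :
    addPair sigmaC₀ (meagerIdeal HilbertCube) = addIdeal (meagerIdeal HilbertCube) := by
  have hsub := sigmaC₀_subset_meagerIdeal
  obtain ⟨𝒜₀, h₀, hc₀⟩ := exists_cover_sigmaC₀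
  have hnot : ⋃₀ 𝒜₀ ∉ meagerIdeal HilbertCube := hc₀ ▸ not_isMeagre_univ_hilbertCube
  apply le_antisymm
  · obtain ⟨𝒜, h1, h2, hcard⟩ : addIdeal (meagerIdeal HilbertCube) ∈
        {κ | ∃ 𝒜 : Set (Set HilbertCube), 𝒜 ⊆ meagerIdeal HilbertCube ∧
          ⋃₀ 𝒜 ∉ meagerIdeal HilbertCube ∧ #𝒜 = κ} :=
      csInf_mem ⟨_, 𝒜₀, h₀.trans hsub, hnot, rfl⟩
    rw [← hcard]
    by_contra hlt
    have hsmall : ∀ B : 𝒜 → Set HilbertCube, (∀ A, B A ∈ sigmaC₀) →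
        IsMeagre (⋃₀ range B) := by
      intro B hB
      by_contra hM
      have : addPair sigmaC₀ (meagerIdeal HilbertCube) ≤ #(range B) :=
        csInf_le' ⟨range B, by rintro _ ⟨A, rfl⟩; exact hB A, hM, rfl⟩
      exact hlt (this.trans mk_range_le)
    have hdiff : ∀ f : 𝒜 → ℕ → ℕ, ∃ g : ℕ → ℕ, ∀ A, ∃ᶠ n in atTop, g n = f A n := by
      intro f
      obtain ⟨x, hx⟩ : ∃ x, x ∉ ⋃₀ range fun A => avoidSet (f A) := by
        by_contra! hall
        refine not_isMeagre_univ_hilbertCube ?_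
        rw [← eq_univ_iff_forall.mpr hall]
        exact hsmall _ fun A => avoidSet_mem_sigmaC₀ _
      exact ⟨pointCode x, fun A => frequently_pointCode_eq fun h => hx ⟨_, ⟨A, rfl⟩, h⟩⟩
    have hbdd : ∀ f : 𝒜 → ℕ → ℕ, ∃ u : ℕ → ℕ, ∀ A, ∀ᶠ n in atTop, f A n ≤ u n := by
      intro f
      obtain ⟨u, hu⟩ := (hsmall _ fun A => hitSet_mem_sigmaC₀ (f A)).exists_bound_hitSet
      exact ⟨u, fun A => hu _ (subset_sUnion_of_mem ⟨A, rfl⟩)⟩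
    choose E hE using fun A : 𝒜 => IsMeagre.exists_cover (h1 A.2)
    obtain ⟨u, hu⟩ := hbdd E
    choose f hf using fun A => hE A u (hu A)
    obtain ⟨g, hg⟩ := hdiff f
    choose h hh using fun A => hf A g (hg A)
    obtain ⟨v, hv⟩ := hbdd h
    exact h2 (IsMeagre.mono (sUnion_subset fun A hA => hh ⟨A, hA⟩ v (hv ⟨A, hA⟩))
      (isMeagre_image_binaryCube (isMeagre_arraysOff u g v)))
  · refine csInf_le_csInf' ⟨_, 𝒜₀, h₀, hnot, rfl⟩ ?_
    rintro _ ⟨𝒜, h1, h2, rfl⟩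
    exact ⟨𝒜, h1.trans hsub, h2, rfl⟩

/-- Each member of a cofinal family yields a bounding function and a point outside it, whose code
serves as a guess. Triples of members then index a base of the meagre ideal. -/
theorem cofPair_sigmaC₀ :
    cofPair sigmaC₀ (meagerIdeal HilbertCube) = cofIdeal (meagerIdeal HilbertCube) := by
  have hsub := sigmaC₀_subset_meagerIdeal
  apply le_antisymm
  · refine csInf_le_csInf' ⟨_, meagerIdeal HilbertCube, subset_rfl,
      fun B hB => ⟨B, hB, subset_rfl⟩, rfl⟩ ?_
    rintro _ ⟨𝒜, h1, h2, rfl⟩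
    exact ⟨𝒜, h1, fun B hB => h2 B (hsub hB), rfl⟩
  · obtain ⟨𝒟, h1, h2, hcard⟩ : cofPair sigmaC₀ (meagerIdeal HilbertCube) ∈
        {κ | ∃ 𝒜 : Set (Set HilbertCube), 𝒜 ⊆ meagerIdeal HilbertCube ∧
          (∀ B ∈ sigmaC₀, ∃ A ∈ 𝒜, B ⊆ A) ∧ #𝒜 = κ} :=
      csInf_mem ⟨_, meagerIdeal HilbertCube, subset_rfl,
        fun B hB => ⟨B, hsub hB, subset_rfl⟩, rfl⟩
    rw [← hcard]
    have hout : ∀ D : 𝒟, ∃ x, x ∉ (D : Set HilbertCube) := by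
      intro D
      by_contra! hall
      exact not_isMeagre_univ_hilbertCube (eq_univ_iff_forall.mpr hall ▸ h1 D.2)
    have hinf : ℵ₀ ≤ #𝒟 := by
      by_contra hlt
      have hc : 𝒟.Countable := mk_le_aleph0_iff.mp (not_le.mp hlt).le
      have : Countable 𝒟 := hc
      choose x hx using hout
      obtain ⟨D, hD, hsubD⟩ := h2 (range x) (countable_mem_sigmaC₀ (countable_range x))
      exact hx ⟨D, hD⟩ (hsubD (mem_range_self _))
    choose x hx using hout
    choose u hu using fun D : 𝒟 => IsMeagre.exists_bound_hitSet (h1 D.2)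
    have hdom : ∀ f : ℕ → ℕ, ∃ D : 𝒟, ∀ᶠ n in atTop, f n ≤ u D n := by
      intro f
      obtain ⟨D, hD, hf⟩ := h2 _ (hitSet_mem_sigmaC₀ f)
      exact ⟨⟨D, hD⟩, hu ⟨D, hD⟩ f hf⟩
    have hguess : ∀ f : ℕ → ℕ, ∃ D : 𝒟, ∃ᶠ n in atTop, pointCode (x D) n = f n := by
      intro f
      obtain ⟨D, hD, hf⟩ := h2 _ (avoidSet_mem_sigmaC₀ f)
      exact ⟨⟨D, hD⟩, frequently_pointCode_eq fun h => hx ⟨D, hD⟩ (hf h)⟩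
    let N : 𝒟 × 𝒟 × 𝒟 → Set HilbertCube := fun p =>
      binaryCube '' arraysOff (u p.1) (pointCode (x p.2.1)) (u p.2.2)
    have hN : cofIdeal (meagerIdeal HilbertCube) ≤ #(range N) := by
      refine csInf_le' ⟨range N, ?_, fun M hM => ?_, rfl⟩
      · rintro _ ⟨p, rfl⟩
        exact isMeagre_image_binaryCube (isMeagre_arraysOff _ _ _)
      · obtain ⟨E, hE⟩ := IsMeagre.exists_cover hM
        obtain ⟨D₁, h₁⟩ := hdom E
        obtain ⟨f, hf⟩ := hE _ h₁
        obtain ⟨D₂, h₂⟩ := hguess f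
        obtain ⟨h, hh⟩ := hf _ h₂
        obtain ⟨D₃, h₃⟩ := hdom h
        exact ⟨_, ⟨(D₁, D₂, D₃), rfl⟩, hh _ h₃⟩
    refine hN.trans (mk_range_le.trans_eq ?_)
    simp only [mk_prod, lift_id, mul_eq_self hinf]

theorem aleph0_le_covIdeal_meagerIdeal : ℵ₀ ≤ covIdeal (meagerIdeal HilbertCube) := by
  obtain ⟨𝒜, h1, h2, h3⟩ := exists_covIdeal_eq exists_cover_meagerIdeal
  rw [← h3]
  by_contra hlt
  have hc : 𝒜.Countable := mk_le_aleph0_iff.mp (not_le.mp hlt).le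
  refine not_isMeagre_univ_hilbertCube ?_
  rw [← h2, sUnion_eq_biUnion]
  exact isMeagre_biUnion hc fun A hA => h1 hA

theorem exists_cantorSet_cover_hilbertCube :
    ∃ ℬ ⊆ {C : Set HilbertCube | IsCantorSet C}, ⋃₀ ℬ = univ ∧
      #ℬ ≤ covIdeal (meagerIdeal HilbertCube) := by
  obtain ⟨F, hF, hcard⟩ := exists_eventuallyDifferentFamily_covIdeal
  choose 𝒜 h1 h2 h3 using avoidSet_mem_sigmaC₀
  refine ⟨⋃ f ∈ F, 𝒜 f, iUnion₂_subset fun f _ C hC => (h1 f hC).1, ?_, ?_⟩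
  · rw [eq_univ_iff_forall]
    intro x
    obtain ⟨_, ⟨f, hf, rfl⟩, hx⟩ := hF.sUnion_avoidSet.symm ▸ mem_univ x
    obtain ⟨C, hC, hxC⟩ := h3 f hx
    exact ⟨C, mem_biUnion hf hC, hxC⟩
  · refine (mk_biUnion_le 𝒜 F).trans ?_
    have hinf := aleph0_le_covIdeal_meagerIdeal
    refine (mul_le_mul' hcard (ciSup_le' fun f => ?_)).trans_eq (mul_eq_self hinf)
    exact (mk_le_aleph0_iff.mpr (h2 f)).trans hinf

theorem covIdeal_cantorSet_hilbertCube :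
    covIdeal {C : Set HilbertCube | IsCantorSet C} = covIdeal (meagerIdeal HilbertCube) := by
  obtain ⟨ℬ, h1, h2, h3⟩ := exists_cantorSet_cover_hilbertCube
  exact le_antisymm ((covIdeal_le h1 h2).trans h3)
    (covIdeal_anti (fun C hC => hC.isNowhereDense_hilbertCube.isMeagre) ⟨ℬ, h1, h2⟩)

theorem exists_cantorSet_cover_unitInterval :
    ∃ ℬ ⊆ {C : Set unitInterval | IsCantorSet C}, ⋃₀ ℬ = univ ∧
      #ℬ ≤ covIdeal (meagerIdeal HilbertCube) := by
  obtain ⟨F, hF, hcard⟩ := exists_eventuallyDifferentFamily_covIdeal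
  have hex : ∀ p : F × ℕ, ∃ C : Set unitInterval, IsCantorSet C ∧
      binaryPoint '' avoidRow (Ici p.2) p.1 ⊆ C := fun p =>
    exists_isCantorSet_superset
      ((isClosed_avoidRow _ _).isCompact.image continuous_binaryPoint).isClosed
      (isNowhereDense_image_binaryPoint (isClosed_avoidRow _ _)
        (isNowhereDense_avoidRow (eventually_ge_atTop p.2) _))
  choose C hC hsub using hex
  refine ⟨range C, by rintro _ ⟨p, rfl⟩; exact hC p, ?_, mk_range_le.trans ?_⟩
  · rw [eq_univ_iff_forall]
    intro x
    obtain ⟨w, rfl⟩ := binaryPoint_surjective x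
    obtain ⟨f, hf, hne⟩ := hF (nextOne w)
    obtain ⟨m, hm⟩ := eventually_atTop.mp hne
    exact ⟨_, ⟨(⟨f, hf⟩, m), rfl⟩, hsub _ ⟨w, fun n hn h => hm n hn h.nextOne_eq, rfl⟩⟩
  · have hinf := aleph0_le_covIdeal_meagerIdeal
    simp only [mk_prod, lift_id, mk_nat]
    exact (mul_le_mul' hcard hinf).trans_eq (mul_eq_self hinf)

theorem covIdeal_cantorSet_unitInterval :
    covIdeal {C : Set unitInterval | IsCantorSet C} = covIdeal (meagerIdeal HilbertCube) := by
  obtain ⟨ℬ, h1, h2, h3⟩ := exists_cantorSet_cover_unitInterval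
  refine le_antisymm ((covIdeal_le h1 h2).trans h3) ?_
  obtain ⟨𝒜, h4, h5, h6⟩ := exists_covIdeal_eq ⟨ℬ, h1, h2⟩
  rw [← h6]
  -- The projection is open, so preimages of closed nowhere dense sets are nowhere dense.
  refine (covIdeal_le (𝒜 := (fun C => (fun x : HilbertCube => x 0) ⁻¹' C) '' 𝒜) ?_ ?_).trans
    mk_image_le
  · rintro _ ⟨C, hC, rfl⟩
    have hCc : IsCantorSet C := h4 hC
    have hn := hCc.isNowhereDense_unitInterval
    refine IsNowhereDense.isMeagre ?_
    have hc : Continuous fun x : HilbertCube => x 0 := continuous_apply 0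
    rw [IsNowhereDense, hCc.isCompact.isClosed.closure_eq] at hn
    rw [IsNowhereDense, (hCc.isCompact.isClosed.preimage hc).closure_eq,
      ← (isOpenMap_eval 0).preimage_interior_eq_interior_preimage hc, hn, preimage_empty]
  · rw [eq_univ_iff_forall]
    intro x
    obtain ⟨C, hC, hx⟩ : x 0 ∈ ⋃₀ 𝒜 := h5 ▸ mem_univ _
    exact ⟨_, ⟨C, hC, rfl⟩, hx⟩

theorem theorem1p5 :
    covIdeal sigmaC₀ = covIdeal (meagerIdeal HilbertCube) ∧
    nonIdeal sigmaC₀ = nonIdeal (meagerIdeal HilbertCube) ∧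
    addPair sigmaC₀ (meagerIdeal HilbertCube) = addIdeal (meagerIdeal HilbertCube) ∧
    cofPair sigmaC₀ (meagerIdeal HilbertCube) = cofIdeal (meagerIdeal HilbertCube) ∧
    covIdeal {C : Set unitInterval | IsCantorSet C} =
      covIdeal {C : Set HilbertCube | IsCantorSet C} :=
  ⟨covIdeal_sigmaC₀, nonIdeal_sigmaC₀, addPair_sigmaC₀, cofPair_sigmaC₀,
    covIdeal_cantorSet_unitInterval.trans covIdeal_cantorSet_hilbertCube.symm⟩
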